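/- For $n\ge 0$ let $X_n$ be the number of comparisons used by Quicksort when sorting $n$ distinct numbers in uniformly random order; that is, $X_0=0$ and, for $n\ge 1$, $$X_n \overset{d}{=} X_{U_n-1}+X^*_{n-U_n}+n-1,$$ where $U_n$ is uniformly distributed on $\{1,\dots,n\}$, $X_j^*\overset{d}{=}X_j$, and $U_n,X_0,\dots,X_{n-1},X_0^*,\dots,X_{n-1}^*$ are independent. Let $Z$ be a random variable with the limiting normalized Quicksort distribution, i.e. $Z$ is the limit in distribution, as $n\to\infty$, of $Z_n:=(X_n-\mathbb{E}X_n)/n$. Let $\gamma:=\left(2-\frac{1}{\ln 2}\right)^{-1}$. (i) As $x\to\infty$, $$\exp\left(-e^{\gamma x+\ln\ln x+O(1)}\right)\le \mathbb{P}(Z\le -x)\le \exp\left(-e^{\gamma x+O(1)}\right).$$ (ii) As $x\to\infty$, $$\exp\left(-x\ln x-x\ln\ln x+O(x)\right)\le \mathbb{P}(Z\ge x)\le \exp\left(-x\ln x+O(x)\right).$$ -/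

import Mathlib

open MeasureTheory Filter Asymptotics

/-- The law of the number `X_n` of comparisons used by Quicksort on `n` distinct numbers in
uniformly random order: `X_0 = 0`, and `X_{n+1}` has the law of `X_j + X*_{n-j} + n`, where `j` is
uniform on `{0, …, n}` (so `j + 1` is the uniform rank of the pivot among `n + 1` numbers) and,
given `j`, the two summands are independent with the laws of `X_j` and `X_{n-j}`. -/
noncomputable def quicksortLaw : ℕ → PMF ℕ
  | 0 => PMF.pure 0
  | n + 1 =>
    (PMF.uniformOfFintype (Fin (n + 1))).bind fun j =>
      (quicksortLaw j.val).bind fun a =>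
        (quicksortLaw (n - j.val)).bind fun b =>
          PMF.pure (a + b + n)
  termination_by n => n
  decreasing_by all_goals omega

/-- The expected number `E X_n` of comparisons. -/
noncomputable def quicksortMean (n : ℕ) : ℝ :=
  ∫ k : ℕ, (k : ℝ) ∂(quicksortLaw n).toMeasure

/-- The normalized variable `Z_n = (X_n - E X_n) / n`, as a function of the value `k` of `X_n`;
it is a random variable on `ℕ` equipped with the law of `X_n`. -/
noncomputable def quicksortNormalized (n : ℕ) (k : ℕ) : ℝ :=
  ((k : ℝ) - quicksortMean n) / n

/-- `Z` has the limiting normalized Quicksort distribution: it is the limit in distribution of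
`Z_n = (X_n - E X_n) / n` as `n → ∞`. -/
def IsQuicksortLimit {Ω : Type*} [MeasurableSpace Ω] (P : Measure Ω) [IsProbabilityMeasure P]
    (Z : Ω → ℝ) : Prop :=
  TendstoInDistribution quicksortNormalized atTop Z (fun n => (quicksortLaw n).toMeasure) P

/-!
Put `Y_n = (X_n - E X_n) / (n + 1)`. If the first pivot leaves lists of lengths `j` and `i`, then,
with `w = (j + 1) / (j + i + 2)`,
`Y_{j+i+1} = w Y_j + (1 - w) Y*_i + b` (`quicksortCentred_split`), where the weights sum exactly to
one. The toll `b` averages to zero over the pivot, lies in `[-1, 1]`, is at least `1 - 2 H(w)` with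
`H` the binary entropy, and is asymptotically equal to it; all this follows from
`E X_n = 2 (n + 1) h_n - 4 n` and the monotonicity of `h_n - log n`, where `h_n` is the harmonic
number. The proof stays with this finite recursion and never needs the fixed point equation of the
limit law.

*Upper bounds.* A function `K` dominates all the cumulant generating functions of `Y_n`
(or of `-Y_n`) once it is compatible with one step of the recursion (`quicksortExp_exp_le`), and
Chernoff's bound passes to the limit. For the right tail `K t = 100 (e ^ t - 1 - t)` works, and
`t = log x` gives `exp (-x log x + O(x))`. For the left tail the main term of `K` is `κ t log t`
with `κ = 1 / γ = 2 - 1 / log 2`: one step changes the exponent by at most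
`t (2 H(w) - 1) - κ t H(w) = t (H(w) / log 2 - 1)` up to a bounded error, and this is never positive
since `H ≤ log 2`. In both cases small `t` is handled by the vanishing mean of the toll, and large
`t` by a multiple of `w (1 - w)` in the exponent, whose exponential averages to something small
(`sum_exp_neg_pivotWeight_le`).

*Lower bounds.* By the portmanteau theorem the tails of `Z` inherit a recursive lower bound
(`IsQuicksortLimit.mul_le_measureReal`). For the left tail, splits with `w` near `1 / 2` move the
threshold by `2 log 2 - 1` and square the probability; windows whose widths decrease geometrically
cost only a constant in total, and `γ (2 log 2 - 1) = log 2`. For the right tail, splits with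
`w ≤ 1 / (x log x)` gain almost one unit at the cost of a factor of order `1 / (x log x)`.
-/

/-! ### Expectations under the law of the comparison count -/

lemma PMF.integrable_of_support_subset {α : Type*} [MeasurableSpace α]
    [MeasurableSingletonClass α] (p : PMF α) (S : Finset α) (hS : p.support ⊆ S) (f : α → ℝ) :
    Integrable f p.toMeasure := by
  have hr : p.toMeasure.restrict (S : Set α) = p.toMeasure := by
    apply Measure.restrict_eq_self_of_ae_mem
    rw [ae_iff]
    exact (p.toMeasure_apply_eq_zero_iff S.measurableSet.compl).2
      (Set.disjoint_left.2 fun a ha h => h (hS ha))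
  rw [← hr]
  exact IntegrableOn.finset

/-- A probability mass function of finite support integrates as a finite sum over any finite set
containing the support. -/
lemma PMF.integral_eq_sum_of_support_subset {α : Type*} [MeasurableSpace α]
    [MeasurableSingletonClass α] (p : PMF α) (S : Finset α) (hS : p.support ⊆ S) (f : α → ℝ) :
    ∫ a, f a ∂p.toMeasure = ∑ a ∈ S, (p a).toReal * f a := by
  have hf := p.integrable_of_support_subset S hS f
  rw [PMF.integral_eq_tsum p f hf, tsum_eq_sum (s := S)]
  · simp
  · intro a ha
    have : p a = 0 := by
      by_contra h
      exact ha (hS ((p.mem_support_iff a).2 h))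
    simp [this]

lemma PMF.integral_bind_of_finite_support {α β : Type*} [MeasurableSpace α]
    [MeasurableSingletonClass α] [MeasurableSpace β] [MeasurableSingletonClass β]
    (p : PMF α) (q : α → PMF β)
    (hp : p.support.Finite) (hq : ∀ a, (q a).support.Finite) (f : β → ℝ) :
    ∫ b, f b ∂(p.bind q).toMeasure = ∫ a, (∫ b, f b ∂(q a).toMeasure) ∂p.toMeasure := by
  classical
  set S := hp.toFinset with hS
  set T := S.biUnion fun a => (hq a).toFinset with hT
  have hqT : ∀ a ∈ S, (q a).support ⊆ T := by
    intro a ha b hb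
    simp only [hT, Finset.coe_biUnion, Set.mem_iUnion]
    exact ⟨a, ha, by simpa using hb⟩
  rw [(p.bind q).integral_eq_sum_of_support_subset T, p.integral_eq_sum_of_support_subset S]
  · have h1 : ∀ b, ((p.bind q) b).toReal = ∑ a ∈ S, (p a).toReal * (q a b).toReal := by
      intro b
      rw [PMF.bind_apply, tsum_eq_sum (s := S), ENNReal.toReal_sum]
      · simp
      · intro a _
        exact ENNReal.mul_ne_top (p.apply_ne_top a) ((q a).apply_ne_top b)
      · intro a ha
        have : p a = 0 := by
          by_contra h
          exact ha (by simpa [hS] using h)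
        simp [this]
    simp_rw [h1, Finset.sum_mul]
    rw [Finset.sum_comm]
    refine Finset.sum_congr rfl fun a ha => ?_
    rw [(q a).integral_eq_sum_of_support_subset T (hqT a ha), Finset.mul_sum]
    exact Finset.sum_congr rfl fun b _ => by ring
  · simp [hS]
  · intro b hb
    rw [PMF.support_bind] at hb
    simp only [Set.mem_iUnion] at hb
    obtain ⟨a, ha, hb⟩ := hb
    exact hqT a (by simpa [hS] using ha) hb

lemma PMF.finite_support_bind {α β : Type*} (p : PMF α) (q : α → PMF β) (hp : p.support.Finite)
    (hq : ∀ a, (q a).support.Finite) : (p.bind q).support.Finite := by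
  rw [PMF.support_bind]
  exact hp.biUnion fun a _ => hq a

lemma quicksortLaw_support_finite (n : ℕ) : (quicksortLaw n).support.Finite := by
  induction n using Nat.strong_induction_on with
  | _ n ih =>
    cases n with
    | zero => rw [quicksortLaw]; simp
    | succ n =>
      rw [quicksortLaw]
      refine PMF.finite_support_bind _ _ (Set.toFinite _) fun j => ?_
      refine PMF.finite_support_bind _ _ (ih _ (by omega)) fun a => ?_
      refine PMF.finite_support_bind _ _ (ih _ (by omega)) fun b => ?_
      simp

/-- The expectation of `f X_n`. -/
noncomputable def quicksortExp (n : ℕ) (f : ℕ → ℝ) : ℝ :=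
  ∫ k : ℕ, f k ∂(quicksortLaw n).toMeasure

lemma quicksortExp_integrable (n : ℕ) (f : ℕ → ℝ) :
    Integrable f (quicksortLaw n).toMeasure :=
  PMF.integrable_of_support_subset _ (quicksortLaw_support_finite n).toFinset (by simp) f

lemma quicksortExp_zero (f : ℕ → ℝ) : quicksortExp 0 f = f 0 := by
  rw [quicksortExp, quicksortLaw, PMF.toMeasure_pure, integral_dirac]

/-- The Quicksort recursion for expectations: condition on the rank of the first pivot. -/
lemma quicksortExp_succ (n : ℕ) (f : ℕ → ℝ) :
    quicksortExp (n + 1) f = (∑ j ∈ Finset.range (n + 1),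
      quicksortExp j fun a => quicksortExp (n - j) fun b => f (a + b + n)) / (n + 1) := by
  have h2 : ∀ j a : ℕ, ((quicksortLaw (n - j)).bind fun b =>
      PMF.pure (a + b + n)).support.Finite := fun j a =>
    PMF.finite_support_bind _ _ (quicksortLaw_support_finite _) fun b => by simp
  have h1 : ∀ j : ℕ, ((quicksortLaw j).bind fun a => (quicksortLaw (n - j)).bind fun b =>
      PMF.pure (a + b + n)).support.Finite := fun j =>
    PMF.finite_support_bind _ _ (quicksortLaw_support_finite _) (h2 j)
  unfold quicksortExp
  rw [quicksortLaw, PMF.integral_bind_of_finite_support (PMF.uniformOfFintype (Fin (n + 1))) _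
      (Set.toFinite _) fun j => h1 j, PMF.integral_eq_sum, Finset.sum_range, Finset.sum_div]
  refine Finset.sum_congr rfl fun j _ => ?_
  rw [PMF.integral_bind_of_finite_support _ _ (quicksortLaw_support_finite _) (h2 j)]
  have h3 : ∀ a : ℕ, ∫ b, f b ∂((quicksortLaw (n - j)).bind fun b =>
      PMF.pure (a + b + n)).toMeasure = ∫ b, f (a + b + n) ∂(quicksortLaw (n - j)).toMeasure := by
    intro a
    rw [PMF.integral_bind_of_finite_support _ _ (quicksortLaw_support_finite _)
      fun b => by simp]
    simp [PMF.toMeasure_pure]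
  simp_rw [h3]
  simp [PMF.uniformOfFintype_apply, ENNReal.toReal_add, div_eq_inv_mul]

lemma quicksortExp_const (n : ℕ) (c : ℝ) : quicksortExp n (fun _ => c) = c := by
  simp [quicksortExp]

lemma quicksortExp_const_mul (n : ℕ) (c : ℝ) (f : ℕ → ℝ) :
    quicksortExp n (fun k => c * f k) = c * quicksortExp n f :=
  integral_const_mul _ _

lemma quicksortExp_add (n : ℕ) (f g : ℕ → ℝ) :
    quicksortExp n (fun k => f k + g k) = quicksortExp n f + quicksortExp n g :=
  integral_add (quicksortExp_integrable n f) (quicksortExp_integrable n g)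

lemma quicksortExp_mono (n : ℕ) {f g : ℕ → ℝ} (h : ∀ k, f k ≤ g k) :
    quicksortExp n f ≤ quicksortExp n g :=
  integral_mono (quicksortExp_integrable n f) (quicksortExp_integrable n g) h

lemma quicksortExp_nonneg (n : ℕ) {f : ℕ → ℝ} (h : ∀ k, 0 ≤ f k) : 0 ≤ quicksortExp n f :=
  integral_nonneg h

/-! ### The mean and the toll function -/

lemma quicksortMean_succ (n : ℕ) :
    quicksortMean (n + 1) = n + (∑ j ∈ Finset.range (n + 1),
      (quicksortMean j + quicksortMean (n - j))) / (n + 1) := by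
  have h : ∀ m, quicksortMean m = quicksortExp m fun k => (k : ℝ) := fun m => rfl
  have hn : (n : ℝ) + 1 ≠ 0 := by positivity
  rw [h, quicksortExp_succ]
  have : ∀ j ∈ Finset.range (n + 1), (quicksortExp j fun a => quicksortExp (n - j) fun b =>
      ((a + b + n : ℕ) : ℝ)) = (quicksortMean j + quicksortMean (n - j)) + n := by
    intro j _
    push_cast
    simp_rw [quicksortExp_add, quicksortExp_const, ← h]
  rw [Finset.sum_congr rfl this, Finset.sum_add_distrib]
  simp
  field_simp
  ring

lemma quicksortMean_zero : quicksortMean 0 = 0 := by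
  have : quicksortMean 0 = quicksortExp 0 fun k => (k : ℝ) := rfl
  rw [this, quicksortExp_zero]
  simp

lemma quicksortMean_eq (n : ℕ) : quicksortMean n = 2 * (n + 1) * harmonic n - 4 * n := by
  have hsum : ∀ m : ℕ, 2 * ∑ j ∈ Finset.range (m + 1), (2 * (j + 1) * (harmonic j : ℝ) - 4 * j)
      = (m + 1) * ((2 * (m + 2) * harmonic (m + 1) - 4 * (m + 1)) - m) := by
    intro m
    induction m with
    | zero => norm_num [harmonic]
    | succ m ih =>
      rw [Finset.sum_range_succ, mul_add, ih, harmonic_succ (m + 1)]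
      push_cast
      have : (m : ℝ) + 1 + 1 ≠ 0 := by positivity
      field_simp
      ring
  induction n using Nat.strong_induction_on with
  | _ n ih =>
    cases n with
    | zero => simp [quicksortMean_zero]
    | succ n =>
      have hflip : ∑ j ∈ Finset.range (n + 1), quicksortMean (n - j)
          = ∑ j ∈ Finset.range (n + 1), quicksortMean j := Finset.sum_flip _
      have hcongr : ∑ j ∈ Finset.range (n + 1), quicksortMean j
          = ∑ j ∈ Finset.range (n + 1), (2 * (j + 1) * (harmonic j : ℝ) - 4 * j) :=
        Finset.sum_congr rfl fun j hj => ih j (Finset.mem_range.1 hj)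
      rw [quicksortMean_succ, Finset.sum_add_distrib, hflip, ← two_mul, hcongr, hsum]
      have : (n : ℝ) + 1 ≠ 0 := by positivity
      push_cast
      field_simp
      ring

/-- The variable `(X_n - E X_n) / (n + 1)`, as a function of the value `k` of `X_n`. With the
denominator `n + 1` in place of `n` the weights in `quicksortCentred_split` sum to one. -/
noncomputable def quicksortCentred (n k : ℕ) : ℝ := (k - quicksortMean n) / (n + 1)

/-- The centred and normalized toll of a partitioning step that splits the `p + q` external nodes
of the recursion tree into `p` and `q`. -/
noncomputable def quicksortToll (p q : ℕ) : ℝ :=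
  1 + 2 * ((p * harmonic p + q * harmonic q) / (p + q) - harmonic (p + q))

lemma quicksortToll_eq (j i : ℕ) :
    quicksortToll (j + 1) (i + 1) = ((j + i : ℕ) + quicksortMean j + quicksortMean i
      - quicksortMean (j + i + 1)) / (j + i + 2) := by
  have e : j + 1 + (i + 1) = (j + i + 1) + 1 := by omega
  rw [quicksortToll, quicksortMean_eq, quicksortMean_eq, quicksortMean_eq, e,
    harmonic_succ j, harmonic_succ i, harmonic_succ (j + i + 1)]
  push_cast
  have : (j : ℝ) + 1 ≠ 0 := by positivity
  have : (i : ℝ) + 1 ≠ 0 := by positivity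
  have : (j : ℝ) + i + 2 ≠ 0 := by positivity
  have : (j : ℝ) + i + 1 + 1 ≠ 0 := by positivity
  have : (j : ℝ) + 1 + (i + 1) ≠ 0 := by positivity
  field_simp
  ring

/-- The pathwise recursion for the centred variables; the weights sum to one. -/
lemma quicksortCentred_split (j i a b : ℕ) :
    quicksortCentred (j + i + 1) (a + b + (j + i)) =
      (j + 1) / (j + i + 2) * quicksortCentred j a + (i + 1) / (j + i + 2) * quicksortCentred i b
        + quicksortToll (j + 1) (i + 1) := by
  rw [quicksortToll_eq]
  unfold quicksortCentred
  push_cast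
  have : (j : ℝ) + 1 ≠ 0 := by positivity
  have : (i : ℝ) + 1 ≠ 0 := by positivity
  have : (j : ℝ) + i + 2 ≠ 0 := by positivity
  have : (j : ℝ) + i + 1 + 1 ≠ 0 := by positivity
  field_simp
  ring

lemma sum_quicksortToll (n : ℕ) :
    ∑ j ∈ Finset.range (n + 1), quicksortToll (j + 1) (n - j + 1) = 0 := by
  have h : ∀ j ∈ Finset.range (n + 1), quicksortToll (j + 1) (n - j + 1) =
      ((quicksortMean j + quicksortMean (n - j)) + (n - quicksortMean (n + 1))) / (n + 2) := by
    intro j hj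
    obtain ⟨i, rfl⟩ := Nat.exists_eq_add_of_le (Nat.lt_succ_iff.1 (Finset.mem_range.1 hj))
    rw [Nat.add_sub_cancel_left, quicksortToll_eq]
    push_cast
    ring
  rw [Finset.sum_congr rfl h, ← Finset.sum_div, Finset.sum_add_distrib, quicksortMean_succ]
  simp only [Finset.sum_const, Finset.card_range, nsmul_eq_mul]
  have : (n : ℝ) + 1 ≠ 0 := by positivity
  push_cast
  field_simp
  ring

lemma harmonic_mono {m n : ℕ} (h : m ≤ n) : (harmonic m : ℝ) ≤ harmonic n := by
  refine monotone_nat_of_le_succ (f := fun n => (harmonic n : ℝ)) (fun n => ?_) h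
  simp only [harmonic_succ]
  push_cast
  have : (0 : ℝ) ≤ ((n : ℝ) + 1)⁻¹ := by positivity
  linarith

lemma quicksortToll_le_one {p q : ℕ} (hp : 0 < p) : quicksortToll p q ≤ 1 := by
  have h1 := harmonic_mono (Nat.le_add_right p q)
  have h2 := harmonic_mono (Nat.le_add_left q p)
  have hp' : (0 : ℝ) < p := by exact_mod_cast hp
  have : (p * harmonic p + q * harmonic q : ℝ) / (p + q) ≤ harmonic (p + q) := by
    rw [div_le_iff₀ (by positivity)]
    nlinarith [mul_le_mul_of_nonneg_left h1 hp'.le,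
      mul_le_mul_of_nonneg_left h2 (Nat.cast_nonneg (α := ℝ) q)]
  unfold quicksortToll
  linarith

open Real in
/-- The toll exceeds its continuous counterpart `1 - 2 H(w)` by a weighted difference of the
sequence `harmonic n - log n`. -/
lemma quicksortToll_eq_binEntropy {p q : ℕ} (hp : 0 < p) (hq : 0 < q) :
    quicksortToll p q = 1 - 2 * binEntropy (p / (p + q)) +
      2 * (p / (p + q) * (eulerMascheroniSeq' p - eulerMascheroniSeq' (p + q)) +
        q / (p + q) * (eulerMascheroniSeq' q - eulerMascheroniSeq' (p + q))) := by
  have hp' : (0 : ℝ) < p := by exact_mod_cast hp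
  have hq' : (0 : ℝ) < q := by exact_mod_cast hq
  have e : (1 : ℝ) - p / (p + q) = q / (p + q) := by field_simp; ring
  have hs : p + q ≠ 0 := by omega
  simp only [quicksortToll, eulerMascheroniSeq', binEntropy_eq_negMulLog_add_negMulLog_one_sub, e,
    negMulLog, hp.ne', hq.ne', hs, if_false]
  rw [log_div hp'.ne' (by positivity), log_div hq'.ne' (by positivity)]
  push_cast
  field_simp
  ring

open Real in
lemma one_sub_binEntropy_le_quicksortToll {p q : ℕ} (hp : 0 < p) (hq : 0 < q) :
    1 - 2 * binEntropy (p / (p + q)) ≤ quicksortToll p q := by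
  have h1 := strictAnti_eulerMascheroniSeq'.antitone (Nat.le_add_right p q)
  have h2 := strictAnti_eulerMascheroniSeq'.antitone (Nat.le_add_left q p)
  rw [quicksortToll_eq_binEntropy hp hq]
  have := mul_nonneg (by positivity : (0 : ℝ) ≤ p / (p + q)) (sub_nonneg.2 h1)
  have := mul_nonneg (by positivity : (0 : ℝ) ≤ q / (p + q)) (sub_nonneg.2 h2)
  linarith

open Real in
lemma neg_one_le_quicksortToll {p q : ℕ} (hp : 0 < p) (hq : 0 < q) : -1 ≤ quicksortToll p q := by
  have h := one_sub_binEntropy_le_quicksortToll hp hq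
  have h' : binEntropy ((p : ℝ) / (p + q)) ≤ log 2 := binEntropy_le_log_two
  have := log_two_lt_d9
  linarith

open Real in
/-- The toll converges to `1 - 2 H(w)`, uniformly as both parts grow. -/
lemma exists_quicksortToll_sub_le {ε : ℝ} (hε : 0 < ε) : ∃ M : ℕ, 0 < M ∧ ∀ p q : ℕ,
    M ≤ p → M ≤ q → quicksortToll p q ≤ 1 - 2 * binEntropy (p / (p + q)) + ε := by
  have h := tendsto_eulerMascheroniSeq'.eventually
    (gt_mem_nhds (lt_add_of_pos_right eulerMascheroniConstant (half_pos hε)))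
  obtain ⟨M, hM⟩ := eventually_atTop.1 h
  refine ⟨M + 1, by omega, fun p q hp hq => ?_⟩
  have hp' : (0 : ℝ) < p := by exact_mod_cast (show 0 < p by omega)
  have hq' : (0 : ℝ) < q := by exact_mod_cast (show 0 < q by omega)
  have h1 := hM p (by omega)
  have h2 := hM q (by omega)
  have h3 := eulerMascheroniConstant_lt_eulerMascheroniSeq' (p + q)
  rw [quicksortToll_eq_binEntropy (by omega) (by omega)]
  have e : (p : ℝ) / (p + q) + q / (p + q) = 1 := by field_simp
  have := mul_le_mul_of_nonneg_left (show eulerMascheroniSeq' p - eulerMascheroniSeq' (p + q) ≤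
    ε / 2 by linarith) (by positivity : (0 : ℝ) ≤ p / (p + q))
  have := mul_le_mul_of_nonneg_left (show eulerMascheroniSeq' q - eulerMascheroniSeq' (p + q) ≤
    ε / 2 by linarith) (by positivity : (0 : ℝ) ≤ q / (p + q))
  have e2 : (p : ℝ) / (p + q) * (ε / 2) + q / (p + q) * (ε / 2) = ε / 2 := by
    rw [← add_mul, e, one_mul]
  linarith

/-! ### Exponential moments by induction -/

/-- The weight `(j + 1) / (n + 2)` of the left part when the pivot of a list of length `n + 1` has
exactly `j` smaller elements. -/
noncomputable def pivotWeight (n j : ℕ) : ℝ := (j + 1) / (n + 2)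

lemma one_sub_pivotWeight {n j : ℕ} (h : j ≤ n) :
    1 - pivotWeight n j = ((n - j : ℕ) + 1) / (n + 2) := by
  rw [pivotWeight, Nat.cast_sub h]
  have : (n : ℝ) + 2 ≠ 0 := by positivity
  field_simp
  ring

lemma pivotWeight_pos (n j : ℕ) : 0 < pivotWeight n j := by
  unfold pivotWeight; positivity

lemma pivotWeight_lt_one {n j : ℕ} (h : j ≤ n) : pivotWeight n j < 1 := by
  have := one_sub_pivotWeight h
  have : (0 : ℝ) < ((n - j : ℕ) + 1) / (n + 2) := by positivity
  linarith

lemma quicksortCentred_split_pivotWeight {n j : ℕ} (h : j ≤ n) (a b : ℕ) :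
    quicksortCentred (n + 1) (a + b + n) =
      pivotWeight n j * quicksortCentred j a + (1 - pivotWeight n j) * quicksortCentred (n - j) b
        + quicksortToll (j + 1) (n - j + 1) := by
  rw [one_sub_pivotWeight h]
  obtain ⟨i, rfl⟩ := Nat.exists_eq_add_of_le h
  rw [Nat.add_sub_cancel_left, quicksortCentred_split]
  simp [pivotWeight]

lemma pivotWeight_eq_div {n j : ℕ} (h : j ≤ n) :
    pivotWeight n j = ((j + 1 : ℕ) : ℝ) / ((j + 1 : ℕ) + (n - j + 1 : ℕ)) := by
  push_cast [Nat.cast_sub h]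
  rw [pivotWeight]
  congr 1
  ring

/-- A function `K` dominates the cumulant generating functions of all the variables
`σ (X_n - E X_n) / (n + 1)` as soon as it is compatible with one step of the recursion. -/
lemma quicksortExp_exp_le {σ : ℝ} {K : ℝ → ℝ} (hK : ∀ t, 0 ≤ t → 0 ≤ K t)
    (h : ∀ n : ℕ, ∀ t, 0 ≤ t → ∑ j ∈ Finset.range (n + 1),
      Real.exp (σ * t * quicksortToll (j + 1) (n - j + 1) -
        (K t - K (t * pivotWeight n j) - K (t * (1 - pivotWeight n j)))) ≤ n + 1) (n : ℕ) :
    ∀ t, 0 ≤ t → quicksortExp n (fun k => Real.exp (σ * t * quicksortCentred n k)) ≤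
      Real.exp (K t) := by
  induction n using Nat.strong_induction_on with
  | _ n ih =>
    intro t ht
    cases n with
    | zero =>
      rw [quicksortExp_zero]
      simpa [quicksortCentred, quicksortMean_zero] using hK t ht
    | succ n =>
      rw [quicksortExp_succ, div_le_iff₀ (by positivity)]
      calc _ ≤ ∑ j ∈ Finset.range (n + 1), Real.exp (K t) *
            Real.exp (σ * t * quicksortToll (j + 1) (n - j + 1) -
              (K t - K (t * pivotWeight n j) - K (t * (1 - pivotWeight n j)))) := by
            refine Finset.sum_le_sum fun j hj => ?_
            have hj' : j ≤ n := Nat.lt_succ_iff.1 (Finset.mem_range.1 hj)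
            have hw := (pivotWeight_pos n j).le
            have hw' := sub_nonneg.2 (pivotWeight_lt_one hj').le
            have e : ∀ a b : ℕ, Real.exp (σ * t * quicksortCentred (n + 1) (a + b + n)) =
                Real.exp (σ * t * quicksortToll (j + 1) (n - j + 1)) *
                Real.exp (σ * (t * pivotWeight n j) * quicksortCentred j a) *
                Real.exp (σ * (t * (1 - pivotWeight n j)) * quicksortCentred (n - j) b) := by
              intro a b
              rw [quicksortCentred_split_pivotWeight hj', ← Real.exp_add, ← Real.exp_add]
              congr 1
              ring
            have e2 : Real.exp (K t) *
                Real.exp (σ * t * quicksortToll (j + 1) (n - j + 1) -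
                (K t - K (t * pivotWeight n j) - K (t * (1 - pivotWeight n j)))) =
                Real.exp (K (t * (1 - pivotWeight n j))) *
                (Real.exp (σ * t * quicksortToll (j + 1) (n - j + 1)) *
                Real.exp (K (t * pivotWeight n j))) := by
              simp only [← Real.exp_add]
              congr 1
              ring
            simp_rw [e, quicksortExp_const_mul]
            rw [e2]
            have h1 := ih j (by omega) _ (mul_nonneg ht hw)
            have h2 := ih (n - j) (by omega) _ (mul_nonneg ht hw')
            simp_rw [mul_comm _ (quicksortExp (n - j) _), quicksortExp_const_mul]
            have h3 := quicksortExp_nonneg j (f := fun k =>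
              Real.exp (σ * (t * pivotWeight n j) * quicksortCentred j k))
              fun k => (Real.exp_pos _).le
            gcongr
        _ ≤ Real.exp (K t) * (n + 1) := by
            rw [← Finset.mul_sum]
            exact mul_le_mul_of_nonneg_left (h n t ht) (Real.exp_pos _).le
        _ = _ := by rfl

lemma sum_pivotWeight_mul_one_sub (n : ℕ) :
    ((n : ℝ) + 1) / 6 ≤ ∑ j ∈ Finset.range (n + 1), pivotWeight n j * (1 - pivotWeight n j) := by
  have h1 : ∀ m : ℕ, ∑ j ∈ Finset.range (m + 1), ((j : ℝ) + 1) = (m + 1) * (m + 2) / 2 := by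
    intro m
    induction m with
    | zero => simp
    | succ m ih => rw [Finset.sum_range_succ, ih]; push_cast; ring
  have h2 : ∀ m : ℕ, ∑ j ∈ Finset.range (m + 1), ((j : ℝ) + 1) ^ 2
      = ((m : ℝ) + 1) * (m + 2) * (2 * m + 3) / 6 := by
    intro m
    induction m with
    | zero => norm_num
    | succ m ih => rw [Finset.sum_range_succ, ih]; push_cast; ring
  have hn : (n : ℝ) + 2 ≠ 0 := by positivity
  have e : ∀ j ∈ Finset.range (n + 1), pivotWeight n j * (1 - pivotWeight n j) =
      ((j : ℝ) + 1) * (1 / (n + 2)) - (j + 1) ^ 2 * (1 / (n + 2) ^ 2) := by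
    intro j _
    unfold pivotWeight
    field_simp
  rw [Finset.sum_congr rfl e, Finset.sum_sub_distrib, ← Finset.sum_mul, ← Finset.sum_mul, h1, h2]
  have : ((n : ℝ) + 1) * (n + 2) / 2 * (1 / (n + 2)) -
      (n + 1) * (n + 2) * (2 * n + 3) / 6 * (1 / (n + 2) ^ 2)
      = ((n : ℝ) + 1) / 6 + (n + 1) / (6 * (n + 2)) := by
    field_simp
    ring
  rw [this]
  have : (0 : ℝ) ≤ (n + 1) / (6 * (n + 2)) := by positivity
  linarith

/-- One step of the induction for small arguments `τ`: the linear term `τ * toll` averages to zero,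
and the quadratic terms are absorbed by `y`. -/
lemma sum_exp_toll_sub_le_of_small {τ : ℝ} (hτ : |τ| ≤ 1 / 2) (n : ℕ) (y : ℕ → ℝ)
    (hy : ∀ j ≤ n, 16 * τ ^ 2 * (pivotWeight n j * (1 - pivotWeight n j)) ≤ y j) :
    ∑ j ∈ Finset.range (n + 1), Real.exp (τ * quicksortToll (j + 1) (n - j + 1) - y j)
      ≤ n + 1 := by
  have key : ∀ j ∈ Finset.range (n + 1),
      Real.exp (τ * quicksortToll (j + 1) (n - j + 1) - y j) ≤
        1 + τ * quicksortToll (j + 1) (n - j + 1) + τ ^ 2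
          - 6 * τ ^ 2 * (pivotWeight n j * (1 - pivotWeight n j)) := by
    intro j hj
    have hj' : j ≤ n := Nat.lt_succ_iff.1 (Finset.mem_range.1 hj)
    have hw := pivotWeight_pos n j
    have hw' := sub_pos.2 (pivotWeight_lt_one hj')
    set w := pivotWeight n j
    set b := quicksortToll (j + 1) (n - j + 1)
    have hb1 : b ≤ 1 := quicksortToll_le_one (by omega)
    have hb2 : -1 ≤ b := neg_one_le_quicksortToll (by omega) (by omega)
    have hb : |b| ≤ 1 := abs_le.2 ⟨hb2, hb1⟩
    have hq : 0 < w * (1 - w) := mul_pos hw hw'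
    have hq4 : w * (1 - w) ≤ 1 / 4 := by nlinarith [sq_nonneg (w - 1 / 2)]
    have hτ2 : τ ^ 2 ≤ 1 / 4 := by
      rw [← sq_abs]; nlinarith [abs_nonneg τ]
    have ha : |τ * b| ≤ 1 / 2 := by
      rw [abs_mul]
      nlinarith [abs_nonneg τ, abs_nonneg b]
    have hexp := (abs_le.1 (Real.abs_exp_sub_one_sub_id_le (ha.trans (by norm_num)))).2
    set a := τ * b
    have ha2 : a ^ 2 ≤ τ ^ 2 := by
      have : b ^ 2 ≤ 1 := by rw [← sq_abs]; nlinarith [abs_nonneg b]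
      have : a ^ 2 = τ ^ 2 * b ^ 2 := by ring
      nlinarith [sq_nonneg τ]
    set Y := 16 * τ ^ 2 * (w * (1 - w)) with hY
    have hY0 : 0 ≤ Y := by positivity
    have hY1 : Y ≤ 1 := by nlinarith [sq_nonneg τ]
    have h1 : Real.exp (-y j) ≤ 1 / (1 + Y) := by
      calc Real.exp (-y j) ≤ Real.exp (-Y) := Real.exp_le_exp.2 (neg_le_neg (hy j hj'))
        _ = 1 / Real.exp Y := by rw [Real.exp_neg, one_div]
        _ ≤ 1 / (1 + Y) := by
          apply one_div_le_one_div_of_le (by positivity)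
          linarith [Real.add_one_le_exp Y]
    -- Since `Y ≤ 1`, the factor `1 / (1 + Y)` is at most `1 - Y / 2`, and `1 + a + a ^ 2 ≥ 3 / 4`.
    have h2 : 1 / (1 + Y) ≤ 1 - Y / 2 := by
      rw [div_le_iff₀ (by positivity)]
      nlinarith
    have h3 : 3 / 4 ≤ 1 + a + a ^ 2 := by nlinarith [sq_nonneg (a + 1 / 2)]
    calc Real.exp (a - y j) = Real.exp a * Real.exp (-y j) := by rw [← Real.exp_add]; ring_nf
      _ ≤ (1 + a + a ^ 2) * (1 - Y / 2) := by
        apply mul_le_mul (by linarith) (h1.trans h2) (Real.exp_pos _).le (by linarith)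
      _ ≤ 1 + a + a ^ 2 - 3 / 8 * Y := by nlinarith
      _ ≤ 1 + a + τ ^ 2 - 6 * τ ^ 2 * (w * (1 - w)) := by rw [hY]; linarith
  refine (Finset.sum_le_sum key).trans ?_
  rw [Finset.sum_sub_distrib, Finset.sum_add_distrib, Finset.sum_add_distrib, ← Finset.mul_sum,
    ← Finset.mul_sum, sum_quicksortToll]
  simp only [Finset.sum_const, Finset.card_range, nsmul_eq_mul]
  have := mul_le_mul_of_nonneg_left (sum_pivotWeight_mul_one_sub n)
    (by positivity : 0 ≤ 6 * τ ^ 2)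
  push_cast
  linarith

lemma sum_exp_neg_mul_succ_le {x : ℝ} (hx : 0 < x) (m : ℕ) :
    ∑ j ∈ Finset.range m, Real.exp (-(x * (j + 1))) ≤ 1 / x := by
  have h1 : ∀ j ∈ Finset.range m, Real.exp (-(x * (j + 1))) =
      Real.exp (-x) * Real.exp (-x) ^ j := by
    intro j _
    rw [← Real.exp_nat_mul, ← Real.exp_add]
    congr 1
    ring
  have hr : Real.exp (-x) < 1 := by simpa using hx
  rw [Finset.sum_congr rfl h1, ← Finset.mul_sum]
  have h2 : ∑ j ∈ Finset.range m, Real.exp (-x) ^ j ≤ (1 - Real.exp (-x))⁻¹ := by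
    rw [← tsum_geometric_of_lt_one (Real.exp_pos _).le hr]
    exact (summable_geometric_of_lt_one (Real.exp_pos _).le hr).sum_le_tsum _
      fun j _ => by positivity
  refine (mul_le_mul_of_nonneg_left h2 (Real.exp_pos _).le).trans ?_
  rw [← div_eq_mul_inv, div_le_div_iff₀ (by linarith) hx, Real.exp_neg]
  have := Real.add_one_le_exp x
  have hp := Real.exp_pos x
  field_simp
  linarith

/-- Since `w (1 - w)` is at least half the distance of `w` to `{0, 1}`, two geometric series bound
this sum. For large `s` it beats any bounded factor in one step of the induction. -/
lemma sum_exp_neg_pivotWeight_le {s : ℝ} (hs : 0 < s) (n : ℕ) :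
    ∑ j ∈ Finset.range (n + 1), Real.exp (-(s * (pivotWeight n j * (1 - pivotWeight n j))))
      ≤ 8 / s * (n + 1) := by
  have hn : (0 : ℝ) < n + 2 := by positivity
  have hx : 0 < s / (2 * (n + 2)) := by positivity
  have hgeo := sum_exp_neg_mul_succ_le hx (n + 1)
  have h : ∀ j ∈ Finset.range (n + 1),
      Real.exp (-(s * (pivotWeight n j * (1 - pivotWeight n j)))) ≤
        Real.exp (-(s / (2 * (n + 2)) * (j + 1))) +
        Real.exp (-(s / (2 * (n + 2)) * ((n - j : ℕ) + 1))) := by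
    intro j hj
    have hj' : j ≤ n := Nat.lt_succ_iff.1 (Finset.mem_range.1 hj)
    have e1 : s / (2 * (n + 2)) * (j + 1) = s * (pivotWeight n j / 2) := by
      unfold pivotWeight; field_simp
    have e2 : s / (2 * (n + 2)) * ((n - j : ℕ) + 1) = s * ((1 - pivotWeight n j) / 2) := by
      rw [one_sub_pivotWeight hj']; field_simp
    rw [e1, e2]
    have hw := pivotWeight_pos n j
    have hw' := sub_pos.2 (pivotWeight_lt_one hj')
    rcases le_total (pivotWeight n j) (1 / 2) with hle | hle
    · refine le_add_of_le_of_nonneg (Real.exp_le_exp.2 (neg_le_neg ?_)) (Real.exp_pos _).le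
      apply mul_le_mul_of_nonneg_left _ hs.le
      nlinarith
    · refine le_add_of_nonneg_of_le (Real.exp_pos _).le (Real.exp_le_exp.2 (neg_le_neg ?_))
      apply mul_le_mul_of_nonneg_left _ hs.le
      nlinarith
  refine (Finset.sum_le_sum h).trans ?_
  have hflip := Finset.sum_flip (n := n)
    (fun j : ℕ => Real.exp (-(s / (2 * ((n : ℝ) + 2)) * ((j : ℝ) + 1))))
  rw [Finset.sum_add_distrib, hflip]
  have e : 1 / (s / (2 * ((n : ℝ) + 2))) = 2 * (n + 2) / s := by field_simp
  rw [e] at hgeo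
  have : 2 * (2 * ((n : ℝ) + 2) / s) ≤ 8 / s * (n + 1) := by
    rw [div_mul_eq_mul_div, ← mul_div_assoc]
    exact div_le_div_of_nonneg_right (by linarith) hs.le
  linarith

/-! ### The right exponential moments -/

/-- The right-hand side equals `e ^ t + 1 - e ^ (t w) - e ^ (t (1 - w))`, which is concave in `w` and
vanishes at `0` and `1`; compare it with its value at `w = 1 / 2`. -/
lemma exp_convex_split {t w : ℝ} (hw : 0 ≤ w) (hw' : 0 ≤ 1 - w) :
    2 * (w * (1 - w)) * (Real.exp (t / 2) - 1) ^ 2 ≤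
      (Real.exp (t * w) - 1) * (Real.exp (t * (1 - w)) - 1) := by
  wlog h : w ≤ 1 / 2 generalizing w
  · have := this (w := 1 - w) hw' (by linarith) (by linarith)
    rw [sub_sub_cancel] at this
    linarith
  have e : Real.exp t = Real.exp (t / 2) ^ 2 := by
    rw [← Real.exp_nat_mul]; congr 1; push_cast; ring
  have e2 : Real.exp (t * w) * Real.exp (t * (1 - w)) = Real.exp t := by
    rw [← Real.exp_add]; congr 1; ring
  have c1 : Real.exp (t * w) ≤ (1 - 2 * w) * 1 + 2 * w * Real.exp (t / 2) := by
    have := convexOn_exp.2 (Set.mem_univ 0) (Set.mem_univ (t / 2)) (by linarith : 0 ≤ 1 - 2 * w)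
      (by linarith : 0 ≤ 2 * w) (by ring)
    simp only [smul_eq_mul, Real.exp_zero] at this
    rwa [show (1 - 2 * w) * 0 + 2 * w * (t / 2) = t * w by ring] at this
  have c2 : Real.exp (t * (1 - w)) ≤ (1 - 2 * w) * Real.exp t + 2 * w * Real.exp (t / 2) := by
    have := convexOn_exp.2 (Set.mem_univ t) (Set.mem_univ (t / 2)) (by linarith : 0 ≤ 1 - 2 * w)
      (by linarith : 0 ≤ 2 * w) (by ring)
    simp only [smul_eq_mul] at this
    rwa [show (1 - 2 * w) * t + 2 * w * (t / 2) = t * (1 - w) by ring] at this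
  have h2 : 2 * w * (Real.exp (t / 2) - 1) ^ 2 ≤
      (Real.exp (t * w) - 1) * (Real.exp (t * (1 - w)) - 1) := by
    nlinarith
  refine le_trans ?_ h2
  apply mul_le_mul_of_nonneg_right _ (sq_nonneg _)
  nlinarith

lemma exp_le_mul_sq_exp_half_sub_one {t : ℝ} (ht : 1 / 2 ≤ t) :
    Real.exp t ≤ 25 * (Real.exp (t / 2) - 1) ^ 2 := by
  have e : Real.exp t = Real.exp (t / 2) ^ 2 := by
    rw [← Real.exp_nat_mul]; congr 1; push_cast; ring
  have := Real.add_one_le_exp (t / 2)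
  rw [e]
  nlinarith

/-- The exponential moments of the right tail grow at most doubly exponentially. The majorant
`K t = 100 (e ^ t - 1 - t)` satisfies
`K t - K (t w) - K (t (1 - w)) = 100 (e ^ (t w) - 1) (e ^ (t (1 - w)) - 1)`. -/
lemma quicksortExp_exp_le_right (n : ℕ) {t : ℝ} (ht : 0 ≤ t) :
    quicksortExp n (fun k => Real.exp (t * quicksortCentred n k)) ≤
      Real.exp (100 * (Real.exp t - 1 - t)) := by
  have := quicksortExp_exp_le (σ := 1) (K := fun t => 100 * (Real.exp t - 1 - t))
    (fun t _ => by linarith [Real.add_one_le_exp t]) ?_ n t ht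
  · simpa using this
  clear! n t
  intro n t ht
  have hD : ∀ j, 100 * (Real.exp t - 1 - t)
      - 100 * (Real.exp (t * pivotWeight n j) - 1 - t * pivotWeight n j)
      - 100 * (Real.exp (t * (1 - pivotWeight n j)) - 1 - t * (1 - pivotWeight n j)) =
      100 * ((Real.exp (t * pivotWeight n j) - 1) * (Real.exp (t * (1 - pivotWeight n j)) - 1)) := by
    intro j
    have : Real.exp t =
        Real.exp (t * pivotWeight n j) * Real.exp (t * (1 - pivotWeight n j)) := by
      rw [← Real.exp_add]; congr 1; ring
    rw [this]
    ring
  simp only [hD, one_mul]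
  rcases le_total t (1 / 2) with h | h
  · refine sum_exp_toll_sub_le_of_small (by rwa [abs_of_nonneg ht]) n _ fun j hj => ?_
    have hw := mul_nonneg ht (pivotWeight_pos n j).le
    have hw' := mul_nonneg ht (sub_pos.2 (pivotWeight_lt_one hj)).le
    have h1 := Real.add_one_le_exp (t * pivotWeight n j)
    have h2 := Real.add_one_le_exp (t * (1 - pivotWeight n j))
    have h3 : (t * pivotWeight n j) * (t * (1 - pivotWeight n j)) ≤
        (Real.exp (t * pivotWeight n j) - 1) * (Real.exp (t * (1 - pivotWeight n j)) - 1) :=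
      mul_le_mul (by linarith) (by linarith) hw' (by linarith)
    have h4 := mul_nonneg hw hw'
    nlinarith
  · have hterm : ∀ j ∈ Finset.range (n + 1), Real.exp (t * quicksortToll (j + 1) (n - j + 1) -
        100 * ((Real.exp (t * pivotWeight n j) - 1) *
          (Real.exp (t * (1 - pivotWeight n j)) - 1))) ≤
        Real.exp t * Real.exp (-(8 * Real.exp t * (pivotWeight n j * (1 - pivotWeight n j)))) := by
      intro j hj
      have hj' : j ≤ n := Nat.lt_succ_iff.1 (Finset.mem_range.1 hj)
      have hw := (pivotWeight_pos n j).le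
      have hw' := (sub_pos.2 (pivotWeight_lt_one hj')).le
      rw [← Real.exp_add, Real.exp_le_exp]
      have hb : quicksortToll (j + 1) (n - j + 1) ≤ 1 := quicksortToll_le_one (by omega)
      have h1 := exp_convex_split (t := t) hw hw'
      have h2 := mul_le_mul_of_nonneg_left (exp_le_mul_sq_exp_half_sub_one h) (mul_nonneg hw hw')
      have h3 := mul_le_mul_of_nonneg_left hb ht
      nlinarith
    refine (Finset.sum_le_sum hterm).trans ?_
    rw [← Finset.mul_sum]
    have := sum_exp_neg_pivotWeight_le (by positivity : 0 < 8 * Real.exp t) n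
    refine (mul_le_mul_of_nonneg_left this (Real.exp_pos t).le).trans (le_of_eq ?_)
    have := Real.exp_pos t
    field_simp

/-! ### The left exponential moments -/

lemma div_one_add_split {x y : ℝ} (hx : 0 ≤ x) (hy : 0 ≤ y) :
    x * y / (1 + (x + y)) ^ 2 ≤ (x + y) ^ 2 / (1 + (x + y)) - x ^ 2 / (1 + x) - y ^ 2 / (1 + y) := by
  have e : (x + y) ^ 2 / (1 + (x + y)) - x ^ 2 / (1 + x) - y ^ 2 / (1 + y)
      = x * y * (2 + (x + y)) / ((1 + x) * (1 + y) * (1 + (x + y))) := by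
    field_simp
    ring
  rw [e, div_le_div_iff₀ (by positivity) (by positivity)]
  have h0 := mul_nonneg hx hy
  have h1 : (1 + x) * (1 + y) ≤ (1 + (x + y)) * (2 + (x + y)) := by nlinarith
  calc x * y * ((1 + x) * (1 + y) * (1 + (x + y)))
      ≤ x * y * ((1 + (x + y)) * (2 + (x + y)) * (1 + (x + y))) := by gcongr
    _ = _ := by ring

lemma mul_log_one_add_split_nonneg {t w : ℝ} (ht : 0 ≤ t) (hw : 0 ≤ w) (hw' : 0 ≤ 1 - w) :
    0 ≤ t * Real.log (1 + t) - t * w * Real.log (1 + t * w)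
      - t * (1 - w) * Real.log (1 + t * (1 - w)) := by
  have h1 : Real.log (1 + t * w) ≤ Real.log (1 + t) :=
    Real.log_le_log (by positivity) (by nlinarith)
  have h2 : Real.log (1 + t * (1 - w)) ≤ Real.log (1 + t) :=
    Real.log_le_log (by positivity) (by nlinarith)
  have h3 := mul_le_mul_of_nonneg_left h1 (mul_nonneg ht hw)
  have h4 := mul_le_mul_of_nonneg_left h2 (mul_nonneg ht hw')
  nlinarith

open Real in
lemma mul_binEntropy_le_mul_log_one_add_split {t w : ℝ} (ht : 0 ≤ t) (hw : 0 < w)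
    (hw' : 0 < 1 - w) :
    t * binEntropy w - 1 ≤ t * Real.log (1 + t) - t * w * Real.log (1 + t * w)
      - t * (1 - w) * Real.log (1 + t * (1 - w)) := by
  have key : ∀ v : ℝ, 0 < v → v * log (1 + t * v) ≤ v * log (1 + t) + v * log v
      + (1 - v) / (1 + t) := by
    intro v hv
    have h := log_le_sub_one_of_pos (show 0 < (1 + t * v) / ((1 + t) * v) by positivity)
    rw [log_div (by positivity) (by positivity), log_mul (by positivity) hv.ne'] at h
    have h2 := mul_le_mul_of_nonneg_left h hv.le
    have e : v * ((1 + t * v) / ((1 + t) * v) - 1) = (1 - v) / (1 + t) := by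
      field_simp
      ring
    rw [e] at h2
    linarith
  have k1 := mul_le_mul_of_nonneg_left (key w hw) ht
  have k2 := mul_le_mul_of_nonneg_left (key (1 - w) hw') ht
  rw [binEntropy_eq_negMulLog_add_negMulLog_one_sub, negMulLog, negMulLog]
  have e : t * ((1 - w) / (1 + t)) + t * ((1 - (1 - w)) / (1 + t)) ≤ 1 := by
    have : t * ((1 - w) / (1 + t)) + t * ((1 - (1 - w)) / (1 + t)) = t / (1 + t) := by
      field_simp
      ring
    rw [this, div_le_one (by positivity)]
    linarith
  linarith

/-- The exponential moments of the left tail. With `κ = 2 - 1 / log 2` the gain `κ t H(w)` of the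
term `κ t log (1 + t)` leaves the exponent `t (H(w) / log 2 - 1) + O(1)` in the recursion; the term
`216 t ^ 2 / (1 + t)` handles small `t` and compensates the bounded error for large `t`. -/
lemma quicksortExp_exp_le_left (n : ℕ) {t : ℝ} (ht : 0 ≤ t) :
    quicksortExp n (fun k => Real.exp (-t * quicksortCentred n k)) ≤
      Real.exp ((2 - 1 / Real.log 2) * (t * Real.log (1 + t)) + 216 * (t ^ 2 / (1 + t))) := by
  have hl := Real.log_two_gt_d9
  have hl' := Real.log_two_lt_d9
  have hκ0 : 0 ≤ 2 - 1 / Real.log 2 := by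
    rw [sub_nonneg, div_le_iff₀ (by linarith)]; linarith
  have hκ1 : 2 - 1 / Real.log 2 ≤ 1 := by
    have : 1 ≤ 1 / Real.log 2 := by rw [le_div_iff₀ (by linarith)]; linarith
    linarith
  have hκ2 : (2 - (2 - 1 / Real.log 2)) * Real.log 2 = 1 := by
    have : Real.log 2 ≠ 0 := by linarith
    field_simp
    ring
  set κ := 2 - 1 / Real.log 2 with hκ
  have := quicksortExp_exp_le (σ := -1)
    (K := fun t => κ * (t * Real.log (1 + t)) + 216 * (t ^ 2 / (1 + t)))
    (fun t ht => by
      have := Real.log_nonneg (show 1 ≤ 1 + t by linarith)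
      positivity) ?_ n t ht
  · simpa using this
  clear! n t
  intro n t ht
  simp only [neg_one_mul]
  have hf : ∀ j ≤ n, t ^ 2 * (pivotWeight n j * (1 - pivotWeight n j)) / (1 + t) ^ 2 ≤
      t ^ 2 / (1 + t) - (t * pivotWeight n j) ^ 2 / (1 + t * pivotWeight n j) -
        (t * (1 - pivotWeight n j)) ^ 2 / (1 + t * (1 - pivotWeight n j)) := by
    intro j hj
    have hw := mul_nonneg ht (pivotWeight_pos n j).le
    have hw' := mul_nonneg ht (sub_pos.2 (pivotWeight_lt_one hj)).le
    have := div_one_add_split hw hw'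
    rw [show t * pivotWeight n j + t * (1 - pivotWeight n j) = t by ring] at this
    refine le_trans (le_of_eq ?_) this
    ring
  rcases le_total t (1 / 2) with h | h
  · refine sum_exp_toll_sub_le_of_small (by rwa [abs_neg, abs_of_nonneg ht]) n _ fun j hj => ?_
    have hw := (pivotWeight_pos n j).le
    have hw' := (sub_pos.2 (pivotWeight_lt_one hj)).le
    have h1 := mul_nonneg hκ0 (mul_log_one_add_split_nonneg ht hw hw')
    have h2 := hf j hj
    have h3 : 4 / 9 * (t ^ 2 * (pivotWeight n j * (1 - pivotWeight n j))) ≤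
        t ^ 2 * (pivotWeight n j * (1 - pivotWeight n j)) / (1 + t) ^ 2 := by
      rw [le_div_iff₀ (by positivity)]
      have : (1 + t) ^ 2 ≤ 9 / 4 := by nlinarith
      have h0 : 0 ≤ t ^ 2 * (pivotWeight n j * (1 - pivotWeight n j)) := by positivity
      nlinarith
    have h0 : 0 ≤ t ^ 2 * (pivotWeight n j * (1 - pivotWeight n j)) := by positivity
    rw [neg_sq]
    linarith
  · have hterm : ∀ j ∈ Finset.range (n + 1), Real.exp (-t * quicksortToll (j + 1) (n - j + 1) -
        (κ * (t * Real.log (1 + t)) + 216 * (t ^ 2 / (1 + t)) -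
          (κ * (t * pivotWeight n j * Real.log (1 + t * pivotWeight n j)) +
            216 * ((t * pivotWeight n j) ^ 2 / (1 + t * pivotWeight n j))) -
          (κ * (t * (1 - pivotWeight n j) * Real.log (1 + t * (1 - pivotWeight n j))) +
            216 * ((t * (1 - pivotWeight n j)) ^ 2 / (1 + t * (1 - pivotWeight n j)))))) ≤
        Real.exp 1 * Real.exp (-(24 * (pivotWeight n j * (1 - pivotWeight n j)))) := by
      intro j hj
      have hj' : j ≤ n := Nat.lt_succ_iff.1 (Finset.mem_range.1 hj)
      have hw := pivotWeight_pos n j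
      have hw' := sub_pos.2 (pivotWeight_lt_one hj')
      rw [← Real.exp_add, Real.exp_le_exp]
      have hb := one_sub_binEntropy_le_quicksortToll (p := j + 1) (q := n - j + 1)
        (by omega) (by omega)
      rw [← pivotWeight_eq_div hj'] at hb
      have h1 := mul_le_mul_of_nonneg_left hb ht
      have h2 := mul_le_mul_of_nonneg_left (mul_binEntropy_le_mul_log_one_add_split ht hw hw') hκ0
      have h3 : (2 - κ) * Real.binEntropy (pivotWeight n j) ≤ 1 := by
        rw [← hκ2]
        exact mul_le_mul_of_nonneg_left Real.binEntropy_le_log_two (by linarith)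
      have h4 := mul_le_mul_of_nonneg_left h3 ht
      have h5 := hf j hj'
      have h6 : 1 / 9 * (pivotWeight n j * (1 - pivotWeight n j)) ≤
          t ^ 2 * (pivotWeight n j * (1 - pivotWeight n j)) / (1 + t) ^ 2 := by
        rw [le_div_iff₀ (by positivity)]
        have h0 : 0 ≤ pivotWeight n j * (1 - pivotWeight n j) := by positivity
        have : 1 / 9 * (1 + t) ^ 2 ≤ t ^ 2 := by nlinarith
        nlinarith
      linarith
    refine (Finset.sum_le_sum hterm).trans ?_
    rw [← Finset.mul_sum]
    have := sum_exp_neg_pivotWeight_le (by norm_num : (0 : ℝ) < 24) n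
    refine (mul_le_mul_of_nonneg_left this (Real.exp_pos 1).le).trans ?_
    have := Real.exp_one_lt_d9
    have hn : (0 : ℝ) < n + 1 := by positivity
    nlinarith

/-! ### Passing to the limit -/

/-- The tail probability `P(σ (X_n - E X_n) / (n + 1) ≥ s)`; the right tail is `σ = 1` and the left
tail is `σ = -1`. -/
noncomputable def quicksortTail (σ : ℝ) (n : ℕ) (s : ℝ) : ℝ :=
  (quicksortLaw n).toMeasure.real {k | s ≤ σ * quicksortCentred n k}

lemma quicksortTail_eq_quicksortExp (σ : ℝ) (n : ℕ) (s : ℝ) :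
    quicksortTail σ n s =
      quicksortExp n ({k | s ≤ σ * quicksortCentred n k}.indicator fun _ => 1) := by
  rw [quicksortExp, integral_indicator_const _ (MeasurableSet.of_discrete)]
  simp [quicksortTail]

lemma quicksortTail_nonneg (σ : ℝ) (n : ℕ) (s : ℝ) : 0 ≤ quicksortTail σ n s :=
  measureReal_nonneg

lemma quicksortTail_le_exp {σ t k : ℝ} {n : ℕ} (ht : 0 ≤ t) (s : ℝ)
    (h : quicksortExp n (fun m => Real.exp (σ * t * quicksortCentred n m)) ≤ Real.exp k) :
    quicksortTail σ n s ≤ Real.exp (k - t * s) := by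
  rw [quicksortTail_eq_quicksortExp]
  have : ∀ m, {m | s ≤ σ * quicksortCentred n m}.indicator (fun _ => (1 : ℝ)) m ≤
      Real.exp (-(t * s)) * Real.exp (σ * t * quicksortCentred n m) := by
    intro m
    by_cases hm : s ≤ σ * quicksortCentred n m
    · rw [Set.indicator_of_mem (s := {m | s ≤ σ * quicksortCentred n m}) hm, ← Real.exp_add]
      apply Real.one_le_exp
      have := mul_le_mul_of_nonneg_left hm ht
      linarith
    · rw [Set.indicator_of_notMem (s := {m | s ≤ σ * quicksortCentred n m}) hm]
      positivity
  refine (quicksortExp_mono n this).trans ?_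
  rw [quicksortExp_const_mul, sub_eq_neg_add, Real.exp_add]
  exact mul_le_mul_of_nonneg_left h (Real.exp_pos _).le

lemma quicksortNormalized_eq {n : ℕ} (hn : n ≠ 0) (k : ℕ) :
    quicksortNormalized n k = quicksortCentred n k + quicksortCentred n k / n := by
  have : (n : ℝ) ≠ 0 := by exact_mod_cast hn
  have : (n : ℝ) + 1 ≠ 0 := by positivity
  unfold quicksortNormalized quicksortCentred
  field_simp

section Limit

variable {Ω : Type*} [MeasurableSpace Ω] {P : Measure Ω} [IsProbabilityMeasure P] {Z : Ω → ℝ}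

/-- Tail probabilities of the limit bound those of the prelimit from below, up to a shift. -/
lemma IsQuicksortLimit.eventually_lt_quicksortTail (hZ : IsQuicksortLimit P Z) {σ s' s c : ℝ}
    (hs : s' < s) (hc : c < P.real {ω | s ≤ σ * Z ω}) :
    ∀ᶠ n in atTop, c < quicksortTail σ n s' := by
  rcases lt_or_ge c 0 with hc0 | hc0
  · exact Eventually.of_forall fun n => hc0.trans_le (quicksortTail_nonneg σ n s')
  obtain ⟨u, hu', hu⟩ := exists_between hs
  have hG : IsOpen {x : ℝ | u < σ * x} := isOpen_lt continuous_const (by fun_prop)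
  have hlim := ProbabilityMeasure.le_liminf_measure_open_of_tendsto hZ.tendsto hG
  simp only [ProbabilityMeasure.coe_mk] at hlim
  rw [Measure.map_apply_of_aemeasurable hZ.aemeasurable_limit hG.measurableSet] at hlim
  have hc' : ENNReal.ofReal c < P (Z ⁻¹' {x : ℝ | u < σ * x}) :=
    (ENNReal.ofReal_lt_iff_lt_toReal hc0 (measure_ne_top _ _)).2
      (hc.trans_le (measureReal_mono fun ω (hω : s ≤ σ * Z ω) => hu.trans_le hω))
  have hev := eventually_lt_of_lt_liminf (hc'.trans_le hlim)
  have hu0 : Tendsto (fun n : ℕ => u - u / ((n : ℝ) + 1)) atTop (nhds (u - 0)) := by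
    refine tendsto_const_nhds.sub ?_
    exact tendsto_const_nhds.div_atTop
      (tendsto_atTop_add_const_right _ _ tendsto_natCast_atTop_atTop)
  rw [sub_zero] at hu0
  filter_upwards [hev, hu0.eventually (lt_mem_nhds hu'), eventually_ne_atTop 0] with n h1 h2 h3
  rw [Measure.map_apply_of_aemeasurable (hZ.forall_aemeasurable n) hG.measurableSet] at h1
  have h4 := (ENNReal.ofReal_lt_iff_lt_toReal hc0 (measure_ne_top _ _)).1 h1
  refine h4.trans_le (measureReal_mono fun k hk => ?_)
  have hk' : u < σ * quicksortNormalized n k := hk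
  have hn : (0 : ℝ) < n := by exact_mod_cast Nat.pos_of_ne_zero h3
  rw [quicksortNormalized_eq h3] at hk'
  show s' ≤ σ * quicksortCentred n k
  have e : u - u / ((n : ℝ) + 1) = u * (n / (n + 1)) := by field_simp; ring
  have e' : σ * quicksortCentred n k =
    σ * (quicksortCentred n k + quicksortCentred n k / n) * (n / (n + 1)) := by field_simp
  rw [e] at h2
  rw [e']
  exact (h2.trans (mul_lt_mul_of_pos_right hk' (by positivity))).le

/-- Lower bounds for the tail probabilities of the prelimit pass to the limit, up to a shift. -/
lemma IsQuicksortLimit.le_of_eventually_le_quicksortTail (hZ : IsQuicksortLimit P Z)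
    {σ s' s c : ℝ} (hs : s' < s) (hc : ∃ᶠ n in atTop, c ≤ quicksortTail σ n s) :
    c ≤ P.real {ω | s' ≤ σ * Z ω} := by
  by_contra! hlt
  have hF : IsClosed {x : ℝ | s' ≤ σ * x} := isClosed_le continuous_const (by fun_prop)
  have hlim := ProbabilityMeasure.limsup_measure_closed_le_of_tendsto hZ.tendsto hF
  simp only [ProbabilityMeasure.coe_mk] at hlim
  rw [Measure.map_apply_of_aemeasurable hZ.aemeasurable_limit hF.measurableSet] at hlim
  have hlt' : P (Z ⁻¹' {x : ℝ | s' ≤ σ * x}) < ENNReal.ofReal c :=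
    (ENNReal.lt_ofReal_iff_toReal_lt (measure_ne_top _ _)).2 hlt
  have hev := eventually_lt_of_limsup_lt (hlim.trans_lt hlt')
  have hu0 : Tendsto (fun n : ℕ => s + s / (n : ℝ)) atTop (nhds (s + 0)) :=
    tendsto_const_nhds.add (tendsto_const_nhds.div_atTop tendsto_natCast_atTop_atTop)
  rw [add_zero] at hu0
  obtain ⟨n, hcn, h1, h2, h3⟩ := (hc.and_eventually
    (hev.and ((hu0.eventually (lt_mem_nhds hs)).and (eventually_ne_atTop 0)))).exists
  rw [Measure.map_apply_of_aemeasurable (hZ.forall_aemeasurable n) hF.measurableSet] at h1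
  have h4 := (ENNReal.lt_ofReal_iff_toReal_lt (measure_ne_top _ _)).1 h1
  refine absurd (hcn.trans (measureReal_mono fun k hk => ?_)) (not_le.2 h4)
  have hk' : s ≤ σ * quicksortCentred n k := hk
  have hn : (0 : ℝ) < n := by exact_mod_cast Nat.pos_of_ne_zero h3
  show s' ≤ σ * quicksortNormalized n k
  rw [quicksortNormalized_eq h3]
  have : s / n ≤ σ * quicksortCentred n k / n := div_le_div_of_nonneg_right hk' hn.le
  have e : σ * (quicksortCentred n k + quicksortCentred n k / n) =
    σ * quicksortCentred n k + σ * quicksortCentred n k / n := by ring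
  linarith

/-- Chernoff's bound for the limit, from exponential moments of the prelimit. -/
lemma IsQuicksortLimit.measureReal_le_exp (hZ : IsQuicksortLimit P Z) {σ t k s' s : ℝ}
    (ht : 0 ≤ t) (hs : s' < s)
    (h : ∀ n, quicksortExp n (fun m => Real.exp (σ * t * quicksortCentred n m)) ≤ Real.exp k) :
    P.real {ω | s ≤ σ * Z ω} ≤ Real.exp (k - t * s') := by
  refine le_of_forall_lt fun c hc => ?_
  obtain ⟨n, hn⟩ := (hZ.eventually_lt_quicksortTail hs hc).exists
  exact hn.trans_le (quicksortTail_le_exp ht s' (h n))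

lemma card_pivotWeight_mem_Icc {α β : ℝ} (hα : 0 < α) (hαβ : α < β) (hβ : β < 1) (n : ℕ) :
    (β - α) * (n + 2) - 1 ≤
      (((Finset.range (n + 1)).filter fun j => α ≤ pivotWeight n j ∧ pivotWeight n j ≤ β).card
        : ℝ) := by
  have hn : (0 : ℝ) < n + 2 := by positivity
  have hβ0 : 0 < β := hα.trans hαβ
  have hcard : (Finset.Icc ⌈α * (n + 2)⌉₊ ⌊β * (n + 2)⌋₊).card ≤
      ((Finset.range (n + 1)).filter fun j => α ≤ pivotWeight n j ∧ pivotWeight n j ≤ β).card := by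
    apply Finset.card_le_card_of_injOn (fun i => i - 1)
    · intro i hi
      simp only [Finset.coe_Icc, Set.mem_Icc] at hi
      have h1 := Nat.ceil_le.1 hi.1
      have h2 := (Nat.le_floor_iff (by positivity)).1 hi.2
      have hi0 : 0 < i := by
        have : (0 : ℝ) < i := lt_of_lt_of_le (by positivity) h1
        exact_mod_cast this
      have hi1 : i < n + 2 := by
        have : (i : ℝ) < n + 2 := lt_of_le_of_lt h2 (by nlinarith)
        exact_mod_cast this
      have e : ((i - 1 : ℕ) : ℝ) + 1 = i := by
        exact_mod_cast Nat.sub_add_cancel hi0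
      refine Finset.mem_coe.2 (Finset.mem_filter.2
        ⟨Finset.mem_range.2 (show i - 1 < n + 1 by omega), ?_, ?_⟩) <;>
        rw [pivotWeight, e]
      · rwa [le_div_iff₀ hn]
      · rwa [div_le_iff₀ hn]
    · intro i hi i' hi' h
      simp only [Finset.coe_Icc, Set.mem_Icc] at hi hi'
      have hp : 0 < ⌈α * ((n : ℝ) + 2)⌉₊ := Nat.ceil_pos.2 (by positivity)
      have : i - 1 = i' - 1 := h
      omega
  have h1 : (⌈α * ((n : ℝ) + 2)⌉₊ : ℝ) < α * (n + 2) + 1 := Nat.ceil_lt_add_one (by positivity)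
  have h2 : β * ((n : ℝ) + 2) < ⌊β * ((n : ℝ) + 2)⌋₊ + 1 := Nat.lt_floor_add_one _
  have h3 : ((⌊β * ((n : ℝ) + 2)⌋₊ + 1 - ⌈α * ((n : ℝ) + 2)⌉₊ : ℕ) : ℝ) ≤
      (((Finset.range (n + 1)).filter fun j => α ≤ pivotWeight n j ∧ pivotWeight n j ≤ β).card
        : ℝ) := by
    rw [← Nat.card_Icc]; exact_mod_cast hcard
  have h4 : ((⌊β * ((n : ℝ) + 2)⌋₊ : ℝ) + 1 - ⌈α * ((n : ℝ) + 2)⌉₊) ≤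
      ((⌊β * ((n : ℝ) + 2)⌋₊ + 1 - ⌈α * ((n : ℝ) + 2)⌉₊ : ℕ) : ℝ) := by
    rw [sub_le_iff_le_add]
    exact_mod_cast le_tsub_add
  linarith

lemma quicksortTail_succ_ge {σ r s₁ s₂ c₁ c₂ : ℝ} (hc₁ : 0 ≤ c₁) (hc₂ : 0 ≤ c₂) {n : ℕ}
    (S : Finset ℕ) (hS : S ⊆ Finset.range (n + 1))
    (h : ∀ j ∈ S, r ≤ pivotWeight n j * s₁ + (1 - pivotWeight n j) * s₂ +
      σ * quicksortToll (j + 1) (n - j + 1) ∧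
      c₁ ≤ quicksortTail σ j s₁ ∧ c₂ ≤ quicksortTail σ (n - j) s₂) :
    S.card * (c₁ * c₂) / (n + 1) ≤ quicksortTail σ (n + 1) r := by
  have hpos : ∀ k, 0 ≤ {k | r ≤ σ * quicksortCentred (n + 1) k}.indicator (fun _ => (1 : ℝ)) k :=
    fun k => Set.indicator_nonneg (fun _ _ => zero_le_one) _
  rw [quicksortTail_eq_quicksortExp, quicksortExp_succ]
  apply div_le_div_of_nonneg_right _ (by positivity)
  refine le_trans ?_ (Finset.sum_le_sum_of_subset_of_nonneg hS fun j _ _ =>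
    quicksortExp_nonneg j fun a => quicksortExp_nonneg (n - j) fun b => hpos _)
  rw [← nsmul_eq_mul]
  refine Finset.card_nsmul_le_sum _ _ _ fun j hj => ?_
  have hjn : j ≤ n := Nat.lt_succ_iff.1 (Finset.mem_range.1 (hS hj))
  obtain ⟨h1, h2, h3⟩ := h j hj
  rw [quicksortTail_eq_quicksortExp] at h2 h3
  calc c₁ * c₂ ≤ _ := mul_le_mul h2 h3 hc₂ (hc₁.trans h2)
    _ = quicksortExp j fun a => quicksortExp (n - j) fun b =>
        {k | s₁ ≤ σ * quicksortCentred j k}.indicator (fun _ => (1 : ℝ)) a *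
        {k | s₂ ≤ σ * quicksortCentred (n - j) k}.indicator (fun _ => (1 : ℝ)) b := by
      simp_rw [quicksortExp_const_mul, mul_comm _ (quicksortExp (n - j) _), quicksortExp_const_mul]
    _ ≤ _ := by
      refine quicksortExp_mono j fun a => quicksortExp_mono (n - j) fun b => ?_
      by_cases ha : s₁ ≤ σ * quicksortCentred j a
      · by_cases hb : s₂ ≤ σ * quicksortCentred (n - j) b
        · have hab : r ≤ σ * quicksortCentred (n + 1) (a + b + n) := by
            rw [quicksortCentred_split_pivotWeight hjn]
            have := mul_le_mul_of_nonneg_left ha (pivotWeight_pos n j).le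
            have := mul_le_mul_of_nonneg_left hb (sub_pos.2 (pivotWeight_lt_one hjn)).le
            linarith
          rw [Set.indicator_of_mem (s := {k | r ≤ σ * quicksortCentred (n + 1) k}) hab,
            Set.indicator_of_mem (s := {k | s₁ ≤ σ * quicksortCentred j k}) ha,
            Set.indicator_of_mem (s := {k | s₂ ≤ σ * quicksortCentred (n - j) k}) hb, one_mul]
        · rw [Set.indicator_of_notMem (s := {k | s₂ ≤ σ * quicksortCentred (n - j) k}) hb, mul_zero]
          exact hpos _
      · rw [Set.indicator_of_notMem (s := {k | s₁ ≤ σ * quicksortCentred j k}) ha, zero_mul]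
        exact hpos _

lemma abs_quicksortToll_sub_le {ε : ℝ} (hε : 0 < ε) : ∃ M : ℕ, ∀ n j : ℕ, M ≤ j → M ≤ n - j →
    |quicksortToll (j + 1) (n - j + 1) - (1 - 2 * Real.binEntropy (pivotWeight n j))| ≤ ε := by
  obtain ⟨M, hM0, hM⟩ := exists_quicksortToll_sub_le hε
  refine ⟨M, fun n j h1 h2 => ?_⟩
  have hj : j ≤ n := by omega
  rw [pivotWeight_eq_div hj, abs_le]
  have h3 := hM (j + 1) (n - j + 1) (by omega) (by omega)
  have h4 := one_sub_binEntropy_le_quicksortToll (p := j + 1) (q := n - j + 1) (by omega)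
    (by omega)
  constructor <;> linarith

/-- The tails of the limit satisfy a recursive lower bound: to make `σ Z` large, let the first
pivot split in a proportion `w ∈ [α, β]` and make both parts large. -/
lemma IsQuicksortLimit.mul_le_measureReal (hZ : IsQuicksortLimit P Z) {σ α β r s₁ s₂ : ℝ}
    (hα : 0 < α) (hαβ : α < β) (hβ : β < 1)
    (h : ∀ w, α ≤ w → w ≤ β → r ≤ w * s₁ + (1 - w) * s₂ + σ * (1 - 2 * Real.binEntropy w))
    {ε : ℝ} (hε : 0 < ε) :
    (β - α) / 8 * P.real {ω | s₁ ≤ σ * Z ω} * P.real {ω | s₂ ≤ σ * Z ω} ≤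
      P.real {ω | r - ε ≤ σ * Z ω} := by
  set p₁ := P.real {ω | s₁ ≤ σ * Z ω} with hp₁
  set p₂ := P.real {ω | s₂ ≤ σ * Z ω} with hp₂
  have h1 : 0 ≤ p₁ := measureReal_nonneg
  have h2 : 0 ≤ p₂ := measureReal_nonneg
  rcases h1.eq_or_lt with h1 | h1
  · rw [← h1]; simp
  rcases h2.eq_or_lt with h2 | h2
  · rw [← h2]; simp
  have hev₁ := hZ.eventually_lt_quicksortTail (σ := σ) (c := p₁ / 2)
    (sub_lt_self s₁ (by positivity : 0 < ε / 4)) (by rw [← hp₁]; linarith)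
  have hev₂ := hZ.eventually_lt_quicksortTail (σ := σ) (c := p₂ / 2)
    (sub_lt_self s₂ (by positivity : 0 < ε / 4)) (by rw [← hp₂]; linarith)
  obtain ⟨M, hM⟩ := eventually_atTop.1 (hev₁.and hev₂)
  obtain ⟨M', hM'⟩ := abs_quicksortToll_sub_le (by positivity : 0 < ε / (4 * (|σ| + 1)))
  refine hZ.le_of_eventually_le_quicksortTail (s := r - ε / 2) (by linarith) ?_
  have htend : Tendsto (fun n : ℕ => ((n : ℝ) + 2)) atTop atTop :=
    tendsto_atTop_add_const_right _ _ tendsto_natCast_atTop_atTop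
  have hshift : ∀ᶠ n : ℕ in atTop, (β - α) / 8 * p₁ * p₂ ≤ quicksortTail σ (n + 1) (r - ε / 2) := by
    filter_upwards [(htend.const_mul_atTop hα).eventually_ge_atTop ((M + M' + 1 : ℕ) : ℝ),
      (htend.const_mul_atTop (sub_pos.2 hβ)).eventually_ge_atTop ((M + M' + 1 : ℕ) : ℝ),
      (htend.const_mul_atTop (sub_pos.2 hαβ)).eventually_ge_atTop 2] with n hn1 hn2 hn3
    have hn : (0 : ℝ) < n + 2 := by positivity
    have hcard := card_pivotWeight_mem_Icc hα hαβ hβ n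
    refine le_trans ?_ (quicksortTail_succ_ge (s₁ := s₁ - ε / 4) (s₂ := s₂ - ε / 4)
      (c₁ := p₁ / 2) (c₂ := p₂ / 2) (by positivity) (by positivity)
      ((Finset.range (n + 1)).filter fun j => α ≤ pivotWeight n j ∧ pivotWeight n j ≤ β)
      (Finset.filter_subset _ _) ?_)
    · rw [le_div_iff₀ (by positivity)]
      have h5 : (β - α) / 2 * (n + 1) ≤
          (((Finset.range (n + 1)).filter fun j =>
            α ≤ pivotWeight n j ∧ pivotWeight n j ≤ β).card : ℝ) := by
        nlinarith
      have := mul_le_mul_of_nonneg_right h5 (by positivity : 0 ≤ p₁ / 2 * (p₂ / 2))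
      linarith
    · intro j hj
      obtain ⟨hj, hw1, hw2⟩ := Finset.mem_filter.1 hj
      have hjn : j ≤ n := Nat.lt_succ_iff.1 (Finset.mem_range.1 hj)
      have hj1 : M + M' ≤ j := by
        have : ((M + M' + 1 : ℕ) : ℝ) ≤ (j + 1 : ℕ) := by
          refine hn1.trans ?_
          rw [pivotWeight, le_div_iff₀ hn] at hw1
          exact_mod_cast hw1
        have := Nat.cast_le.1 this
        omega
      have hj2 : M + M' ≤ n - j := by
        have : ((M + M' + 1 : ℕ) : ℝ) ≤ (n - j + 1 : ℕ) := by
          refine hn2.trans ?_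
          have h6 := one_sub_pivotWeight hjn
          rw [eq_div_iff hn.ne'] at h6
          push_cast
          rw [← h6]
          exact mul_le_mul_of_nonneg_right (by linarith) hn.le
        have := Nat.cast_le.1 this
        omega
      refine ⟨?_, (hM j (by omega)).1.le, (hM (n - j) (by omega)).2.le⟩
      have h7 := h _ hw1 hw2
      have h8 := hM' n j (by omega) (by omega)
      have h9 : |σ * (quicksortToll (j + 1) (n - j + 1) -
          (1 - 2 * Real.binEntropy (pivotWeight n j)))| ≤ ε / 4 := by
        rw [abs_mul]
        refine (mul_le_mul_of_nonneg_left h8 (abs_nonneg σ)).trans ?_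
        have := abs_nonneg σ
        rw [← mul_div_assoc, div_le_div_iff₀ (by positivity) (by norm_num)]
        nlinarith
      have h10 := (abs_le.1 h9).1
      linarith
  exact (tendsto_add_atTop_nat 1).frequently
    (p := fun n => (β - α) / 8 * p₁ * p₂ ≤ quicksortTail σ n (r - ε / 2)) hshift.frequently

end Limit

/-! ### Upper bounds for the tails -/

section Limit

variable {Ω : Type*} [MeasurableSpace Ω] {P : Measure Ω} [IsProbabilityMeasure P] {Z : Ω → ℝ}

lemma IsQuicksortLimit.right_tail_le (hZ : IsQuicksortLimit P Z) {x : ℝ} (hx : 1 ≤ x) :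
    P.real {ω | x ≤ Z ω} ≤ Real.exp (-x * Real.log x + 100 * x) := by
  have hl := Real.log_nonneg hx
  have h := hZ.measureReal_le_exp (σ := 1) (t := Real.log x) (s := x) (s' := x - 1)
    (k := 100 * (Real.exp (Real.log x) - 1 - Real.log x)) hl (by linarith) fun n => by
      simpa using quicksortExp_exp_le_right n hl
  simp only [one_mul] at h
  refine h.trans (Real.exp_le_exp.2 ?_)
  rw [Real.exp_log (by linarith)]
  nlinarith

lemma two_sub_one_div_log_two_pos : 0 < 2 - 1 / Real.log 2 := by
  have := Real.log_two_gt_d9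
  rw [sub_pos, div_lt_iff₀ (by linarith)]
  linarith

lemma IsQuicksortLimit.left_tail_le (hZ : IsQuicksortLimit P Z) {γ : ℝ}
    (hγ : γ = (2 - 1 / Real.log 2)⁻¹) {x : ℝ} (hx : 219 ≤ x) :
    P.real {ω | Z ω ≤ -x} ≤ Real.exp (-Real.exp (γ * x + -(219 * γ))) := by
  have hκ := two_sub_one_div_log_two_pos
  have hκ1 : 2 - 1 / Real.log 2 ≤ 1 := by
    have hl := Real.log_two_gt_d9
    have hl' := Real.log_two_lt_d9
    have : 1 ≤ 1 / Real.log 2 := by rw [le_div_iff₀ (by linarith)]; linarith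
    linarith
  have hγ0 : 0 < γ := by rw [hγ]; positivity
  have hκγ : (2 - 1 / Real.log 2) * γ = 1 := by rw [hγ]; exact mul_inv_cancel₀ hκ.ne'
  set κ := 2 - 1 / Real.log 2
  -- This `t` satisfies `κ log t = x - 219`, which makes Chernoff's exponent at most `1 - 2 t`.
  set t := Real.exp (γ * x + -(219 * γ)) with ht
  have ht0 : 0 < t := Real.exp_pos _
  have ht1 : 1 ≤ t := Real.one_le_exp (by nlinarith)
  have hlogt : κ * Real.log t = x - 219 := by
    rw [ht, Real.log_exp]
    linear_combination (x - 219) * hκγ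
  have h := hZ.measureReal_le_exp (σ := -1) (t := t) (s := x) (s' := x - 1)
    (k := κ * (t * Real.log (1 + t)) + 216 * (t ^ 2 / (1 + t))) ht0.le (by linarith) fun n => by
      rw [neg_one_mul]
      exact quicksortExp_exp_le_left n ht0.le
  have hset : {ω | Z ω ≤ -x} = {ω | x ≤ -1 * Z ω} := by
    ext ω
    constructor <;> intro h <;> simp only [Set.mem_ofPred_eq] at h ⊢ <;> linarith
  rw [hset]
  refine h.trans (Real.exp_le_exp.2 ?_)
  have h1 : t * Real.log (1 + t) ≤ t * Real.log t + 1 := by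
    have h2 := Real.log_le_sub_one_of_pos (show 0 < (1 + t) / t by positivity)
    rw [Real.log_div (by positivity) ht0.ne'] at h2
    have h3 := mul_le_mul_of_nonneg_left h2 ht0.le
    have e : t * ((1 + t) / t - 1) = 1 := by field_simp; ring
    rw [e] at h3
    linarith
  have h2 : t ^ 2 / (1 + t) ≤ t := by
    rw [div_le_iff₀ (by positivity)]
    nlinarith
  have h3 := mul_le_mul_of_nonneg_left h1 hκ.le
  have h4 : κ * (t * Real.log t) = t * (x - 219) := by rw [← hlogt]; ring
  linarith

/-! ### The lower bound for the left tail -/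

/-- A quadratic lower bound for the binary entropy near its maximum. -/
lemma log_two_sub_le_binEntropy {w : ℝ} (hw : 0 < w) (hw' : w < 1) :
    Real.log 2 - 4 * (w - 1 / 2) ^ 2 ≤ Real.binEntropy w := by
  have h1 : 0 < 1 - w := by linarith
  have key : ∀ v : ℝ, 0 < v → v * (Real.log 2 + Real.log v) ≤ v * (2 * v - 1) := by
    intro v hv
    rw [← Real.log_mul (by norm_num) hv.ne']
    exact mul_le_mul_of_nonneg_left (Real.log_le_sub_one_of_pos (by positivity)) hv.le
  have k1 := key w hw
  have k2 := key (1 - w) h1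
  rw [Real.binEntropy_eq_negMulLog_add_negMulLog_one_sub, Real.negMulLog, Real.negMulLog]
  nlinarith

lemma binEntropy_le_mul_log_add {w : ℝ} (hw : w < 1) :
    Real.binEntropy w ≤ -w * Real.log w + w := by
  have h1 : 0 < 1 - w := by linarith
  have h2 := mul_le_mul_of_nonneg_left (Real.one_sub_inv_le_log_of_pos h1) h1.le
  rw [mul_sub, mul_inv_cancel₀ h1.ne'] at h2
  rw [Real.binEntropy_eq_negMulLog_add_negMulLog_one_sub, Real.negMulLog, Real.negMulLog]
  linarith

lemma exists_half_lt_measureReal (P : Measure Ω) [IsProbabilityMeasure P] (Z : Ω → ℝ) (σ : ℝ) :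
    ∃ K : ℝ, 0 ≤ K ∧ 1 / 2 < P.real {ω | -K ≤ σ * Z ω} := by
  have hmono : Monotone fun n : ℕ => {ω | -(n : ℝ) ≤ σ * Z ω} := by
    intro m n hmn ω (hω : -(m : ℝ) ≤ σ * Z ω)
    have : (m : ℝ) ≤ n := by exact_mod_cast hmn
    show -(n : ℝ) ≤ σ * Z ω
    linarith
  have hU : ⋃ n : ℕ, {ω | -(n : ℝ) ≤ σ * Z ω} = Set.univ := by
    refine Set.eq_univ_of_forall fun ω => Set.mem_iUnion.2 ?_
    obtain ⟨n, hn⟩ := exists_nat_ge (-(σ * Z ω))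
    exact ⟨n, show -(n : ℝ) ≤ σ * Z ω by linarith⟩
  have ht := tendsto_measure_iUnion_atTop (μ := P) hmono
  rw [hU, measure_univ] at ht
  have ht' := (ENNReal.tendsto_toReal ENNReal.one_ne_top).comp ht
  obtain ⟨n, hn⟩ := (ht'.eventually (lt_mem_nhds (by norm_num : (1 / 2 : ℝ) < _))).exists
  exact ⟨n, n.cast_nonneg, hn⟩

lemma IsQuicksortLimit.left_tail_step (hZ : IsQuicksortLimit P Z) {δ : ℝ} (hδ : 0 < δ)
    (hδ' : δ < 1 / 2) (s : ℝ) :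
    δ / 4 * P.real {ω | s ≤ -1 * Z ω} ^ 2 ≤
      P.real {ω | s + (2 * Real.log 2 - 1) - 9 * δ ^ 2 ≤ -1 * Z ω} := by
  have h := hZ.mul_le_measureReal (σ := -1) (α := 1 / 2 - δ) (β := 1 / 2 + δ)
    (r := s + (2 * Real.log 2 - 1) - 8 * δ ^ 2) (s₁ := s) (s₂ := s) (by linarith) (by linarith)
    (by linarith) (fun w h1 h2 => by
      have h3 := log_two_sub_le_binEntropy (w := w) (by linarith) (by linarith)
      have h4 : (w - 1 / 2) ^ 2 ≤ δ ^ 2 := sq_le_sq' (by linarith) (by linarith)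
      linarith) (ε := δ ^ 2) (by positivity)
  rw [show s + (2 * Real.log 2 - 1) - 8 * δ ^ 2 - δ ^ 2 =
    s + (2 * Real.log 2 - 1) - 9 * δ ^ 2 by ring] at h
  refine le_trans (le_of_eq ?_) h
  ring

/-- Iterating `left_tail_step` with windows of width `2 ^ (-k) / 4`: the losses in the position are
summable (the term `3 / 4 * (1 / 4) ^ k` is the part still to be lost), and the factor `2 ^ (k + 5)`
carried along absorbs the losses in probability. -/
lemma IsQuicksortLimit.left_tail_iterate (hZ : IsQuicksortLimit P Z) (s : ℝ) (k : ℕ) :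
    2 ^ (k + 5) * (P.real {ω | s + 3 / 4 ≤ -1 * Z ω} / 32) ^ (2 ^ k) ≤
      P.real {ω | s + k * (2 * Real.log 2 - 1) + 3 / 4 * (1 / 4) ^ k ≤ -1 * Z ω} := by
  induction k with
  | zero =>
    apply le_of_eq
    simp
    ring
  | succ k ih =>
    set q := P.real {ω | s + 3 / 4 ≤ -1 * Z ω} / 32
    have hq : 0 ≤ q := div_nonneg measureReal_nonneg (by norm_num)
    have h2 : (0 : ℝ) < (1 / 2) ^ k := by positivity
    have h2' : ((1 : ℝ) / 2) ^ k ≤ 1 := pow_le_one₀ (by norm_num) (by norm_num)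
    have h := hZ.left_tail_step (δ := (1 / 2) ^ k / 4) (by positivity) (by linarith)
      (s + k * (2 * Real.log 2 - 1) + 3 / 4 * (1 / 4) ^ k)
    have e : s + k * (2 * Real.log 2 - 1) + 3 / 4 * (1 / 4) ^ k + (2 * Real.log 2 - 1)
        - 9 * ((1 / 2) ^ k / 4) ^ 2 =
        s + (k + 1 : ℕ) * (2 * Real.log 2 - 1) + 3 / 4 * (1 / 4) ^ (k + 1) := by
      have : ((1 : ℝ) / 4) ^ k = ((1 / 2) ^ k) ^ 2 := by
        rw [← pow_mul, mul_comm, pow_mul]; norm_num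
      rw [pow_succ (1 / 4 : ℝ) k, this]
      push_cast
      ring
    rw [e] at h
    refine le_trans ?_ h
    have h3 := pow_le_pow_left₀ (by positivity) ih 2
    refine le_trans ?_ (mul_le_mul_of_nonneg_left h3 (by positivity))
    have e2 : ((1 : ℝ) / 2) ^ k * 2 ^ k = 1 := by rw [← mul_pow]; norm_num
    have e3 : (1 / 2 : ℝ) ^ k / 4 / 4 * (2 ^ (k + 5) * q ^ 2 ^ k) ^ 2 =
        ((1 / 2 : ℝ) ^ k * 2 ^ k) * 2 ^ (k + 1 + 5) * q ^ 2 ^ (k + 1) := by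
      rw [pow_succ 2 k, pow_mul q]
      ring
    rw [e3, e2, one_mul]

lemma IsQuicksortLimit.exists_le_left_tail (hZ : IsQuicksortLimit P Z) {γ : ℝ}
    (hγ : γ = (2 - 1 / Real.log 2)⁻¹) :
    ∃ C : ℝ, ∀ᶠ x : ℝ in atTop,
      Real.exp (-Real.exp (γ * x + C)) ≤ P.real {ω | Z ω ≤ -x} := by
  have hl := Real.log_two_gt_d9
  obtain ⟨K, -, hK⟩ := exists_half_lt_measureReal P Z (-1)
  set s := -K - 3 / 4 with hs
  set q := P.real {ω | s + 3 / 4 ≤ -1 * Z ω} / 32 with hq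
  have hq0 : 0 < q := by
    have : s + 3 / 4 = -K := by rw [hs]; ring
    rw [hq, this]
    linarith
  have hq1 : q < 1 := by
    have : P.real {ω | s + 3 / 4 ≤ -1 * Z ω} ≤ 1 := measureReal_le_one
    rw [hq]
    linarith
  have hlogq : 0 < -Real.log q := by have := Real.log_neg hq0 hq1; linarith
  set a := 2 * Real.log 2 - 1 with ha
  have ha0 : 0 < a := by rw [ha]; linarith
  have hγa : γ = Real.log 2 / a := by
    have : Real.log 2 ≠ 0 := by linarith
    rw [hγ, ha]
    field_simp
  refine ⟨Real.log (-Real.log q) + Real.log 2 - γ * s, ?_⟩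
  filter_upwards [eventually_ge_atTop s] with x hx
  set k := ⌈(x - s) / a⌉₊ with hk
  have hk1 : x ≤ s + k * a + 3 / 4 * (1 / 4) ^ k := by
    have h1 := Nat.le_ceil ((x - s) / a)
    rw [div_le_iff₀ ha0] at h1
    have : (0 : ℝ) < 3 / 4 * (1 / 4) ^ k := by positivity
    linarith
  have hk2 : (k : ℝ) < (x - s) / a + 1 := Nat.ceil_lt_add_one (div_nonneg (by linarith) ha0.le)
  have h1 : P.real {ω | s + k * a + 3 / 4 * (1 / 4) ^ k ≤ -1 * Z ω} ≤ P.real {ω | Z ω ≤ -x} :=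
    measureReal_mono fun ω (hω : s + k * a + 3 / 4 * (1 / 4) ^ k ≤ -1 * Z ω) =>
      show Z ω ≤ -x by linarith
  have h2 : q ^ 2 ^ k ≤ 2 ^ (k + 5) * q ^ 2 ^ k :=
    le_mul_of_one_le_left (by positivity) (one_le_pow₀ (by norm_num))
  refine le_trans ?_ (h2.trans ((hZ.left_tail_iterate s k).trans h1))
  have e1 : q ^ 2 ^ k = Real.exp (-(-Real.log q * 2 ^ k)) := by
    rw [← Real.exp_log (pow_pos hq0 (2 ^ k)), Real.log_pow]
    congr 1
    push_cast
    ring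
  rw [e1, Real.exp_le_exp, neg_le_neg_iff]
  have e2 : Real.exp (γ * x + (Real.log (-Real.log q) + Real.log 2 - γ * s)) =
      -Real.log q * Real.exp (γ * (x - s) + Real.log 2) := by
    rw [← Real.exp_log hlogq, ← Real.exp_add, Real.exp_log hlogq]
    congr 1
    ring
  rw [e2]
  apply mul_le_mul_of_nonneg_left _ hlogq.le
  calc (2 : ℝ) ^ k = Real.exp (k * Real.log 2) := by
        rw [Real.exp_nat_mul, Real.exp_log (by norm_num)]
    _ ≤ Real.exp (((x - s) / a + 1) * Real.log 2) :=
        Real.exp_le_exp.2 (mul_le_mul_of_nonneg_right hk2.le (by linarith))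
    _ = _ := by
        rw [hγa]
        congr 1
        ring

/-! ### The lower bound for the right tail -/

/-- A very unbalanced first split raises the right tail by almost one unit. -/
lemma IsQuicksortLimit.right_tail_step (hZ : IsQuicksortLimit P Z) {δ K s x ρ : ℝ} (hδ : 0 < δ)
    (hδ' : δ ≤ 1 / 2) (hK : 0 ≤ K) (hK' : 1 / 2 < P.real {ω | -K ≤ Z ω}) (hx : 0 ≤ x)
    (hs : s ≤ x) (hρ : ρ ≤ 1 - δ * (x + K + 3 + 2 * Real.log (2 / δ))) :
    δ / 32 * P.real {ω | s ≤ Z ω} ≤ P.real {ω | s + ρ ≤ Z ω} := by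
  have hlog : 0 ≤ Real.log (2 / δ) :=
    Real.log_nonneg (by rw [le_div_iff₀ hδ]; linarith)
  have h := hZ.mul_le_measureReal (σ := 1) (α := δ / 2) (β := δ) (s₁ := -K) (s₂ := s)
    (r := s + 1 - δ * (x + K + 2 + 2 * Real.log (2 / δ))) (by linarith) (by linarith)
    (by linarith) (fun w h1 h2 => by
      have hw : 0 < w := by linarith
      have h3 := binEntropy_le_mul_log_add (w := w) (by linarith)
      have h4 : -Real.log w ≤ Real.log (2 / δ) := by
        rw [← Real.log_inv]
        apply Real.log_le_log (by positivity)
        rw [inv_eq_one_div, div_le_div_iff₀ hw hδ]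
        linarith
      have h5 : -w * Real.log w ≤ δ * Real.log (2 / δ) := by
        calc -w * Real.log w = w * -Real.log w := by ring
          _ ≤ w * Real.log (2 / δ) := mul_le_mul_of_nonneg_left h4 hw.le
          _ ≤ _ := mul_le_mul_of_nonneg_right h2 hlog
      have h6 : w * K ≤ δ * K := mul_le_mul_of_nonneg_right h2 hK
      have h7 : w * s ≤ δ * x :=
        (mul_le_mul_of_nonneg_left hs hw.le).trans (mul_le_mul_of_nonneg_right h2 hx)
      nlinarith) (ε := δ) hδ
  simp only [one_mul] at h
  have hmono : P.real {ω | s + 1 - δ * (x + K + 2 + 2 * Real.log (2 / δ)) - δ ≤ Z ω} ≤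
      P.real {ω | s + ρ ≤ Z ω} :=
    measureReal_mono fun ω hω => by
      have hω' : s + 1 - δ * (x + K + 2 + 2 * Real.log (2 / δ)) - δ ≤ Z ω := hω
      show s + ρ ≤ Z ω
      linarith
  refine le_trans ?_ (h.trans hmono)
  apply mul_le_mul_of_nonneg_right _ measureReal_nonneg
  nlinarith

lemma IsQuicksortLimit.right_tail_iterate (hZ : IsQuicksortLimit P Z) {δ K x ρ : ℝ} (hδ : 0 < δ)
    (hδ' : δ ≤ 1 / 2) (hK : 0 ≤ K) (hK' : 1 / 2 < P.real {ω | -K ≤ Z ω}) (hx : 0 ≤ x)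
    (hρ0 : 0 ≤ ρ) (hρ : ρ ≤ 1 - δ * (x + K + 3 + 2 * Real.log (2 / δ))) (k : ℕ)
    (hk : (k - 1) * ρ - K ≤ x) :
    (δ / 32) ^ k / 2 ≤ P.real {ω | -K + k * ρ ≤ Z ω} := by
  induction k with
  | zero => simpa using hK'.le
  | succ k ih =>
    push_cast at hk
    have h1 := ih (by linarith)
    have h2 := hZ.right_tail_step hδ hδ' hK hK' hx (s := -K + k * ρ) (by linarith) hρ
    have e : -K + (k + 1 : ℕ) * ρ = -K + k * ρ + ρ := by push_cast; ring
    rw [e]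
    refine le_trans ?_ h2
    calc (δ / 32) ^ (k + 1) / 2 = δ / 32 * ((δ / 32) ^ k / 2) := by ring
      _ ≤ _ := mul_le_mul_of_nonneg_left h1 (by positivity)

/-- About `x + 4 x / log x` steps with splits of proportion `δ = 1 / (x log x)` reach `x`: each step
gains `1 - 2 / log x`, and costs a factor `δ / 32` in probability. -/
lemma IsQuicksortLimit.exists_le_right_tail (hZ : IsQuicksortLimit P Z) :
    ∃ C : ℝ, ∀ᶠ x : ℝ in atTop,
      Real.exp (-x * Real.log x - x * Real.log (Real.log x) + -(C * x)) ≤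
        P.real {ω | x ≤ Z ω} := by
  obtain ⟨K, hK0, hK⟩ := exists_half_lt_measureReal P Z 1
  simp only [one_mul] at hK
  refine ⟨15 * K + 20, ?_⟩
  have hlog := Real.isLittleO_log_id_atTop.bound (by norm_num : (0 : ℝ) < 1 / 8)
  filter_upwards [hlog, eventually_ge_atTop (2 * K + 10),
    Real.tendsto_log_atTop.eventually_ge_atTop 4] with x hx1 hx2 hl4
  have hx0 : 0 < x := by linarith
  set l := Real.log x with hl
  have hlx : l ≤ x / 8 := by
    simp only [id, Real.norm_eq_abs, abs_of_pos hx0] at hx1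
    linarith [le_abs_self l]
  have hl0 : 0 < l := by linarith
  set m := Real.log l with hm
  have hm0 : 0 ≤ m := Real.log_nonneg (by linarith)
  have hml : m ≤ l := (Real.log_le_sub_one_of_pos hl0).trans (by linarith)
  have hlog2 := Real.log_two_lt_d9
  have hxl : 2 ≤ x * l := by nlinarith
  have hxl0 : 0 < x * l := by linarith
  set δ := 1 / (x * l) with hδ
  have hδ0 : 0 < δ := by positivity
  have hδ1 : δ ≤ 1 / 2 := one_div_le_one_div_of_le (by norm_num) hxl
  have hlogxl : Real.log (x * l) = l + m := Real.log_mul hx0.ne' hl0.ne'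
  have hlogδ : Real.log (2 / δ) = Real.log 2 + (l + m) := by
    rw [hδ, div_div_eq_mul_div, div_one, Real.log_mul (by norm_num) hxl0.ne', hlogxl]
  have hl2 : 2 / l ≤ 1 / 2 := by rw [div_le_div_iff₀ hl0 (by norm_num)]; linarith
  set ρ := 1 - 2 / l with hρ
  have hρ0 : 0 < ρ := by rw [hρ]; linarith
  have hρ1 : ρ ≤ 1 - δ * (x + K + 3 + 2 * Real.log (2 / δ)) := by
    have h1 : x + K + 3 + 2 * Real.log (2 / δ) ≤ 2 * x := by rw [hlogδ]; linarith
    have h2 := mul_le_mul_of_nonneg_left h1 hδ0.le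
    have e : δ * (2 * x) = 2 / l := by rw [hδ]; field_simp
    rw [hρ]
    linarith
  set k := ⌈(x + K) / ρ⌉₊ with hk
  have hk1 : (k : ℝ) < (x + K) / ρ + 1 := Nat.ceil_lt_add_one (by positivity)
  have hk2 : (x + K) / ρ ≤ k := Nat.le_ceil _
  have hk3 : (k - 1) * ρ - K ≤ x := by
    have : (k : ℝ) - 1 < (x + K) / ρ := by linarith
    rw [lt_div_iff₀ hρ0] at this
    linarith
  have hk4 : x ≤ -K + k * ρ := by
    rw [div_le_iff₀ hρ0] at hk2
    linarith
  refine le_trans ?_ ((hZ.right_tail_iterate hδ0 hδ1 hK0 hK hx0.le hρ0.le hρ1 k hk3).trans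
    (measureReal_mono fun ω (hω : -K + k * ρ ≤ Z ω) => show x ≤ Z ω by linarith))
  -- The excess of `k` over `x` is `O(x / log x)`, so it contributes `O(x)` to the exponent.
  have hk5 : (k : ℝ) ≤ x + (K + 1 + 4 * (x + K) / l) := by
    have h1 : 1 / ρ ≤ 1 + 4 / l := by
      rw [div_le_iff₀ hρ0]
      have e : (1 + 4 / l) * ρ = 1 + 2 * (l - 4) / l ^ 2 := by
        rw [hρ]; field_simp; ring
      have : 0 ≤ 2 * (l - 4) / l ^ 2 := div_nonneg (by linarith) (by positivity)
      linarith
    have h2 := mul_le_mul_of_nonneg_left h1 (by positivity : 0 ≤ x + K)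
    have e1 : (x + K) * (1 / ρ) = (x + K) / ρ := by ring
    have e2 : (x + K) * (1 + 4 / l) = x + K + 4 * (x + K) / l := by ring
    linarith
  have hlog32 : Real.log 32 = 5 * Real.log 2 := by
    rw [show (32 : ℝ) = 2 ^ 5 by norm_num, Real.log_pow]; norm_num
  have e3 : (δ / 32) ^ k / 2 = Real.exp (-(k * (l + m + 5 * Real.log 2)) - Real.log 2) := by
    rw [← Real.exp_log (show 0 < (δ / 32) ^ k / 2 by positivity), Real.log_div (by positivity)
      (by norm_num), Real.log_pow, Real.log_div hδ0.ne' (by norm_num), hlog32, hδ, Real.log_div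
      one_ne_zero hxl0.ne', Real.log_one, hlogxl]
    congr 1
    ring
  rw [e3, Real.exp_le_exp]
  have h1 : (k : ℝ) * (l + m + 5 * Real.log 2) ≤
      (x + (K + 1 + 4 * (x + K) / l)) * (l + m + 4) :=
    mul_le_mul hk5 (by linarith) (by have := Real.log_two_gt_d9; linarith) (by positivity)
  have h2 : (K + 1 + 4 * (x + K) / l) * (l + m + 4) ≤ (K + 1 + 4 * (x + K) / l) * (3 * l) :=
    mul_le_mul_of_nonneg_left (by linarith) (by positivity)
  have e4 : (K + 1 + 4 * (x + K) / l) * (3 * l) = 3 * (K + 1) * l + 12 * (x + K) := by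
    field_simp
    ring
  have h3 : 3 * (K + 1) * l ≤ 3 * (K + 1) * x :=
    mul_le_mul_of_nonneg_left (by linarith) (by positivity)
  have h4 : 12 * K ≤ 12 * K * x := le_mul_of_one_le_right (by positivity) (by linarith)
  linarith

end Limit

theorem mainTheorem1 {Ω : Type*} [MeasurableSpace Ω] (P : Measure Ω) [IsProbabilityMeasure P]
    (Z : Ω → ℝ) (hZ : IsQuicksortLimit P Z) (γ : ℝ) (hγ : γ = (2 - 1 / Real.log 2)⁻¹) :
    ((∃ r : ℝ → ℝ, r =O[atTop] (fun _ => (1 : ℝ)) ∧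
        ∀ᶠ x : ℝ in atTop,
          Real.exp (-Real.exp (γ * x + Real.log (Real.log x) + r x)) ≤ P.real {ω | Z ω ≤ -x}) ∧
      (∃ r : ℝ → ℝ, r =O[atTop] (fun _ => (1 : ℝ)) ∧
        ∀ᶠ x : ℝ in atTop,
          P.real {ω | Z ω ≤ -x} ≤ Real.exp (-Real.exp (γ * x + r x)))) ∧
    ((∃ r : ℝ → ℝ, r =O[atTop] (fun x => x) ∧
        ∀ᶠ x : ℝ in atTop,
          Real.exp (-x * Real.log x - x * Real.log (Real.log x) + r x) ≤ P.real {ω | x ≤ Z ω}) ∧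
      (∃ r : ℝ → ℝ, r =O[atTop] (fun x => x) ∧
        ∀ᶠ x : ℝ in atTop,
          P.real {ω | x ≤ Z ω} ≤ Real.exp (-x * Real.log x + r x))) := by
  refine ⟨⟨?_, ?_⟩, ?_, ?_⟩
  · obtain ⟨C, hC⟩ := hZ.exists_le_left_tail hγ
    refine ⟨fun _ => C, isBigO_const_const _ one_ne_zero _, ?_⟩
    filter_upwards [hC, Real.tendsto_log_atTop.eventually_ge_atTop 1] with x hx hl
    refine le_trans (Real.exp_le_exp.2 (neg_le_neg (Real.exp_le_exp.2 ?_))) hx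
    -- The iteration yields a bound without the `log log x` term, which is nonnegative.
    linarith [Real.log_nonneg hl]
  · refine ⟨fun _ => -(219 * γ), isBigO_const_const _ one_ne_zero _, ?_⟩
    filter_upwards [eventually_ge_atTop 219] with x hx
    exact hZ.left_tail_le hγ hx
  · obtain ⟨C, hC⟩ := hZ.exists_le_right_tail
    exact ⟨fun x => -(C * x), ((isBigO_refl _ _).const_mul_left C).neg_left, hC⟩
  · refine ⟨fun x => 100 * x, (isBigO_refl _ _).const_mul_left 100, ?_⟩
    filter_upwards [eventually_ge_atTop 1] with x hx
    exact hZ.right_tail_le hx
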